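/- Throughout, locally convex spaces are real, Hausdorff, locally convex topological vector spaces. A subset $U$ of a locally convex space $E$ is called locally convex with dense interior if each $x\in U$ has a convex neighbourhood in $U$ and the interior $U^\circ$ is dense in $U$. For $r\in\mathbb{N}_0\cup\{\infty\}$ and a locally convex space $F$, a map $f\colon U\to F$ is $C^r$ if for each $k\in\mathbb{N}_0$ with $k\le r$ the iterated directional derivatives $d^{(k)}f(x,y_1,\dots,y_k)=(D_{y_k}\cdots D_{y_1}f)(x)$ exist for $x\in U^\circ$, $y_1,\dots,y_k\in E$, and extend to a (necessarily unique) continuous map $d^{(k)}f\colon U\times E^k\to F$, with $d^{(0)}f=f$ on all of $U$. The space $C^r(U,F)$ of these maps carries the initial topology with respect to the maps $d^{(k)}\colon C^r(U,F)\to C(U\times E^k,F)$, $k\le r$, where spaces $C(\cdot,F)$ of continuous maps carry the compact-open topology. Likewise, if $U\subseteq E_1$ and $V\subseteq E_2$ are locally convex subsets with dense interior and $r,s\in\mathbb{N}_0\cup\{\infty\}$, a map $f\colon U\times V\to F$ is $C^{r,s}$ if for all $i,j\in\mathbb{N}_0$ with $i\le r$, $j\le s$ the iterated directional derivatives $$d^{(i,j)}f(x,y,w_1,\dots,w_i,v_1,\dots,v_j)=(D_{(w_i,0)}\cdots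 D_{(w_1,0)}D_{(0,v_j)}\cdots D_{(0,v_1)}f)(x,y)$$ exist for $x\in U^\circ$, $y\in V^\circ$, $w_1,\dots,w_i\in E_1$, $v_1,\dots,v_j\in E_2$, and extend to a continuous map $d^{(i,j)}f\colon U\times V\times E_1^i\times E_2^j\to F$, with $d^{(0,0)}f=f$; the space $C^{r,s}(U\times V,F)$ carries the initial topology with respect to the maps $d^{(i,j)}\colon C^{r,s}(U\times V,F)\to C(U\times V\times E_1^i\times E_2^j,F)$, $i\le r$, $j\le s$. A topological space is a k-space if it is Hausdorff and carries the final topology with respect to the inclusion maps of its compact subsets. **Theorem (Exponential Law).** Let $E_1$, $E_2$ and $F$ be locally convex spaces, let $U$ and $V$ be locally convex subsets with dense interior of $E_1$ and $E_2$, respectively, and let $r,s\in\mathbb{N}_0\cup\{\infty\}$. Assume that at least one of the following conditions is satisfied: (a) $V$ is locally compact; (b) $r=s=0$ and $U\times V$ is a k-space; (c) $r\ge 1$, $s=0$ and $U\times V\times E_1$ is a k-space; (d) $r=0$, $s\ge 1$ and $U\times V\times E_2$ is a k-space; (e) $r\ge 1$, $s\ge 1$ and $U\times V\times E_1\times E_2$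 is a k-space. Then for each $f\in C^{r,s}(U\times V,F)$ the map $f^\vee\colon x\mapsto f(x,\cdot)$ takes its values in $C^s(V,F)$ and is $C^r$ as a map $U\to C^s(V,F)$, and $$\Phi\colon C^{r,s}(U\times V,F)\to C^r(U,C^s(V,F)),\qquad f\mapsto f^\vee$$ is an isomorphism of topological vector spaces (a linear homeomorphism). Moreover, if $g\colon U\to C^s(V,F)$ is $C^r$, then $g^\wedge\colon U\times V\to F$, $g^\wedge(x,y):=g(x)(y)$, is $C^{r,s}$. -/

import Mathlib

open Filter Topology

set_option linter.unusedSectionVars false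

noncomputable section

/-- A subset `U` of a real topological vector space is a *locally convex subset with dense interior*
if each `x ∈ U` has a convex neighbourhood in `U` (for the subspace topology), and the interior of
`U` is dense in `U`. -/
class IsLocConvexDenseInterior {E : Type*} [AddCommGroup E] [Module ℝ E] [TopologicalSpace E]
    (U : Set E) : Prop where
  locConvex : ∀ x ∈ U, ∃ W ⊆ U, W ∈ 𝓝[U] x ∧ Convex ℝ W
  denseInterior : U ⊆ closure (interior U)

/-- A *k-space* is a Hausdorff space whose topology is the final topology with respect to the
inclusion maps of its compact subsets. -/
structure IsKSpace (X : Type*) [TopologicalSpace X] : Prop where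
  t2 : T2Space X
  coherent : CompactlyCoherentSpace X

section Definitions

variable {E E₁ E₂ F : Type*}
  [AddCommGroup E] [Module ℝ E] [TopologicalSpace E]
  [AddCommGroup E₁] [Module ℝ E₁] [TopologicalSpace E₁]
  [AddCommGroup E₂] [Module ℝ E₂] [TopologicalSpace E₂]
  [AddCommGroup F] [Module ℝ F] [TopologicalSpace F]

/-- `l` is the directional derivative `lim_{t → 0} t⁻¹ (g (x + t h) - g x)` of `g : U → F`
at `x` in the direction `h`. It is only used at points `x` of the interior of `U`, where
`x + t h ∈ U` for all small `t`, so that the value `0` given to `g` outside `U` is irrelevant. -/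
def HasDirDeriv {U : Set E} (g : U → F) (x : U) (h : E) (l : F) : Prop :=
  Tendsto (fun t : ℝ => t⁻¹ • (Function.extend Subtype.val g 0 ((x : E) + t • h) - g x))
    (𝓝[≠] 0) (𝓝 l)

/-! ### `C^r`-maps -/

/-- The functions `D k`, for `k ≤ r`, are the differentials
`d^(k) f : U × E^k → F` of `f : U → F`: they are continuous on `U × E^k`, and on the interior of `U`
they are the iterated directional derivatives
`d^(k) f (x, y₁, …, y_k) = (D_{y_k} ⋯ D_{y₁} f) (x)`. -/
structure HasDiffs (r : ℕ∞) {U : Set E} (f : U → F) (D : ∀ k : ℕ, U × (Fin k → E) → F) :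
    Prop where
  zero : ∀ (x : U) (y : Fin 0 → E), D 0 (x, y) = f x
  continuous : ∀ k : ℕ, (k : ℕ∞) ≤ r → Continuous (D k)
  succ : ∀ k : ℕ, ((k + 1 : ℕ) : ℕ∞) ≤ r → ∀ x : U, (x : E) ∈ interior U →
    ∀ y : Fin (k + 1) → E,
      HasDirDeriv (fun z : U => D k (z, Fin.init y)) x (y (Fin.last k)) (D (k + 1) (x, y))

/-- `f : U → F` is `C^r`. -/
def IsCr (r : ℕ∞) {U : Set E} (f : U → F) : Prop :=
  ∃ D : ∀ k : ℕ, U × (Fin k → E) → F, HasDiffs r f D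

/-! ### `C^{r,s}`-maps -/

/-- The functions `D i j`, for `i ≤ r` and `j ≤ s`, are the differentials
`d^(i,j) f : U × V × E₁^i × E₂^j → F` of `f : U × V → F`: they are continuous, and on the product of
the interiors of `U` and `V` they are the iterated directional derivatives
`(D_{(w_i,0)} ⋯ D_{(w₁,0)} D_{(0,v_j)} ⋯ D_{(0,v₁)} f) (x, y)`. Here the derivative of a function in
the direction `(w,0)` or `(0,v)` is written as the derivative in the direction `w` or `v` of the
partial function of the first or second variable. -/
structure HasDiffs₂ (r s : ℕ∞) {U : Set E₁} {V : Set E₂} (f : U × V → F)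
    (D : ∀ i j : ℕ, U × V × (Fin i → E₁) × (Fin j → E₂) → F) : Prop where
  zero : ∀ (x : U) (y : V) (w : Fin 0 → E₁) (v : Fin 0 → E₂), D 0 0 (x, y, w, v) = f (x, y)
  continuous : ∀ i j : ℕ, (i : ℕ∞) ≤ r → (j : ℕ∞) ≤ s → Continuous (D i j)
  succ_right : ∀ j : ℕ, ((j + 1 : ℕ) : ℕ∞) ≤ s →
    ∀ (x : U) (y : V), (x : E₁) ∈ interior U → (y : E₂) ∈ interior V →
    ∀ (w : Fin 0 → E₁) (v : Fin (j + 1) → E₂),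
      HasDirDeriv (fun z : V => D 0 j (x, z, w, Fin.init v)) y (v (Fin.last j))
        (D 0 (j + 1) (x, y, w, v))
  succ_left : ∀ i j : ℕ, ((i + 1 : ℕ) : ℕ∞) ≤ r → (j : ℕ∞) ≤ s →
    ∀ (x : U) (y : V), (x : E₁) ∈ interior U → (y : E₂) ∈ interior V →
    ∀ (w : Fin (i + 1) → E₁) (v : Fin j → E₂),
      HasDirDeriv (fun z : U => D i j (z, y, Fin.init w, v)) x (w (Fin.last i))
        (D (i + 1) j (x, y, w, v))

/-- `f : U × V → F` is `C^{r,s}`. -/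
def IsCrs (r s : ℕ∞) {U : Set E₁} {V : Set E₂} (f : U × V → F) : Prop :=
  ∃ D : ∀ i j : ℕ, U × V × (Fin i → E₁) × (Fin j → E₂) → F, HasDiffs₂ r s f D

/-! ### Linearity of the conditions -/

theorem hasDirDeriv_zero {U : Set E} (x : U) (h : E) :
    HasDirDeriv (fun _ : U => (0 : F)) x h 0 := by
  have e : Function.extend (Subtype.val : U → E) (fun _ : U => (0 : F)) 0 = 0 :=
    Function.extend_zero _
  unfold HasDirDeriv
  rw [e]
  simpa using tendsto_const_nhds

theorem HasDirDeriv.add [ContinuousAdd F] {U : Set E} {g₁ g₂ : U → F} {x : U} {h : E} {l₁ l₂ : F}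
    (h₁ : HasDirDeriv g₁ x h l₁) (h₂ : HasDirDeriv g₂ x h l₂) :
    HasDirDeriv (fun z => g₁ z + g₂ z) x h (l₁ + l₂) := by
  have e : Function.extend Subtype.val (fun z => g₁ z + g₂ z) (0 : E → F) =
      Function.extend Subtype.val g₁ 0 + Function.extend Subtype.val g₂ 0 := by
    have := Function.extend_add (Subtype.val : U → E) g₁ g₂ (0 : E → F) 0
    rwa [add_zero] at this
  refine (Tendsto.add h₁ h₂).congr fun t => ?_
  rw [e, ← smul_add, Pi.add_apply, add_sub_add_comm]

theorem HasDirDeriv.const_smul [ContinuousConstSMul ℝ F] {U : Set E} {g : U → F} {x : U} {h : E}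
    {l : F} (c : ℝ) (hg : HasDirDeriv g x h l) :
    HasDirDeriv (fun z => c • g z) x h (c • l) := by
  have e : Function.extend Subtype.val (fun z => c • g z) (0 : E → F) =
      c • Function.extend Subtype.val g 0 := by
    have := Function.extend_smul c (Subtype.val : U → E) g (0 : E → F)
    rwa [smul_zero] at this
  refine (Tendsto.const_smul hg c).congr fun t => ?_
  rw [e, Pi.smul_apply, ← smul_sub, smul_comm]

theorem hasDiffs_zero (r : ℕ∞) (U : Set E) :
    HasDiffs r (0 : U → F) (fun k => (0 : U × (Fin k → E) → F)) where
  zero _ _ := rfl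
  continuous _ _ := continuous_const
  succ _ _ x _ _ := hasDirDeriv_zero x _

theorem HasDiffs.add [ContinuousAdd F] {r : ℕ∞} {U : Set E} {f f' : U → F}
    {D D' : ∀ k : ℕ, U × (Fin k → E) → F} (h : HasDiffs r f D) (h' : HasDiffs r f' D') :
    HasDiffs r (f + f') (fun k => D k + D' k) where
  zero x y := congrArg₂ (· + ·) (h.zero x y) (h'.zero x y)
  continuous k hk := (h.continuous k hk).add (h'.continuous k hk)
  succ k hk x hx y := (h.succ k hk x hx y).add (h'.succ k hk x hx y)

theorem HasDiffs.const_smul [ContinuousConstSMul ℝ F] {r : ℕ∞} {U : Set E} {f : U → F}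
    {D : ∀ k : ℕ, U × (Fin k → E) → F} (c : ℝ) (h : HasDiffs r f D) :
    HasDiffs r (c • f) (fun k => c • D k) where
  zero x y := congrArg (c • ·) (h.zero x y)
  continuous k hk := (h.continuous k hk).const_smul c
  succ k hk x hx y := (h.succ k hk x hx y).const_smul c

theorem hasDiffs₂_zero (r s : ℕ∞) (U : Set E₁) (V : Set E₂) :
    HasDiffs₂ r s (0 : U × V → F)
      (fun i j => (0 : U × V × (Fin i → E₁) × (Fin j → E₂) → F)) where
  zero _ _ _ _ := rfl
  continuous _ _ _ _ := continuous_const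
  succ_right _ _ _ y _ _ _ _ := hasDirDeriv_zero y _
  succ_left _ _ _ _ x _ _ _ _ _ := hasDirDeriv_zero x _

theorem HasDiffs₂.add [ContinuousAdd F] {r s : ℕ∞} {U : Set E₁} {V : Set E₂} {f f' : U × V → F}
    {D D' : ∀ i j : ℕ, U × V × (Fin i → E₁) × (Fin j → E₂) → F}
    (h : HasDiffs₂ r s f D) (h' : HasDiffs₂ r s f' D') :
    HasDiffs₂ r s (f + f') (fun i j => D i j + D' i j) where
  zero x y w v := congrArg₂ (· + ·) (h.zero x y w v) (h'.zero x y w v)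
  continuous i j hi hj := (h.continuous i j hi hj).add (h'.continuous i j hi hj)
  succ_right j hj x y hx hy w v :=
    (h.succ_right j hj x y hx hy w v).add (h'.succ_right j hj x y hx hy w v)
  succ_left i j hi hj x y hx hy w v :=
    (h.succ_left i j hi hj x y hx hy w v).add (h'.succ_left i j hi hj x y hx hy w v)

theorem HasDiffs₂.const_smul [ContinuousConstSMul ℝ F] {r s : ℕ∞} {U : Set E₁} {V : Set E₂}
    {f : U × V → F} {D : ∀ i j : ℕ, U × V × (Fin i → E₁) × (Fin j → E₂) → F} (c : ℝ)
    (h : HasDiffs₂ r s f D) : HasDiffs₂ r s (c • f) (fun i j => c • D i j) where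
  zero x y w v := congrArg (c • ·) (h.zero x y w v)
  continuous i j hi hj := (h.continuous i j hi hj).const_smul c
  succ_right j hj x y hx hy w v := (h.succ_right j hj x y hx hy w v).const_smul c
  succ_left i j hi hj x y hx hy w v := (h.succ_left i j hi hj x y hx hy w v).const_smul c

/-! ### The space `C^r(U, F)` with the compact-open `C^r`-topology -/

section CrSpace

variable [IsTopologicalAddGroup F] [ContinuousSMul ℝ F]

/-- The `C^r`-maps form a vector subspace of the space of all functions `U → F`. -/
def crSubmodule (r : ℕ∞) (U : Set E) (F : Type*) [AddCommGroup F] [Module ℝ F]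
    [TopologicalSpace F] [IsTopologicalAddGroup F] [ContinuousSMul ℝ F] :
    Submodule ℝ (U → F) where
  carrier := {f | IsCr r f}
  zero_mem' := ⟨_, hasDiffs_zero r U⟩
  add_mem' := by
    rintro _ _ ⟨D, hD⟩ ⟨D', hD'⟩
    exact ⟨_, hD.add hD'⟩
  smul_mem' := by
    rintro c _ ⟨D, hD⟩
    exact ⟨_, hD.const_smul c⟩

/-- The vector space `C^r(U, F)` of all `C^r`-maps `U → F` (pointwise operations). -/
def CrMap (r : ℕ∞) (U : Set E) (F : Type*) [AddCommGroup F] [Module ℝ F]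
    [TopologicalSpace F] [IsTopologicalAddGroup F] [ContinuousSMul ℝ F] : Type _ :=
  ↥(crSubmodule r U F)

namespace CrMap

variable {r : ℕ∞} {U : Set E}

instance : AddCommGroup (CrMap r U F) := inferInstanceAs (AddCommGroup ↥(crSubmodule r U F))

instance : Module ℝ (CrMap r U F) := inferInstanceAs (Module ℝ ↥(crSubmodule r U F))

instance : CoeFun (CrMap r U F) (fun _ => U → F) := ⟨fun f => Subtype.val f⟩

theorem isCr (f : CrMap r U F) : IsCr r (f : U → F) := Subtype.property f

/-- The differential `d^(k) f : U × E^k → F` of a `C^r`-map `f` (meaningful for `k ≤ r`). -/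
def diff (f : CrMap r U F) (k : ℕ) : U × (Fin k → E) → F := Classical.choose f.isCr k

theorem hasDiffs (f : CrMap r U F) : HasDiffs r (f : U → F) f.diff :=
  Classical.choose_spec f.isCr

/-- The differential `d^(k) f`, for `k ≤ r`, as an element of `C(U × E^k, F)`. -/
def diffC (k : ℕ) (hk : (k : ℕ∞) ≤ r) (f : CrMap r U F) : C(U × (Fin k → E), F) :=
  ⟨f.diff k, f.hasDiffs.continuous k hk⟩

/-- The compact-open `C^r`-topology: the initial topology with respect to the maps
`d^(k) : C^r(U, F) → C(U × E^k, F)`, `k ≤ r`, where `C(U × E^k, F)` carries the compact-open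
topology. -/
instance : TopologicalSpace (CrMap r U F) :=
  ⨅ (k : ℕ) (hk : (k : ℕ∞) ≤ r), TopologicalSpace.induced (diffC k hk) inferInstance

end CrMap

end CrSpace

/-! ### The space `C^{r,s}(U × V, F)` with the compact-open `C^{r,s}`-topology -/

section CrsSpace

variable [IsTopologicalAddGroup F] [ContinuousSMul ℝ F]

/-- The `C^{r,s}`-maps form a vector subspace of the space of all functions `U × V → F`. -/
def crsSubmodule (r s : ℕ∞) (U : Set E₁) (V : Set E₂) (F : Type*) [AddCommGroup F] [Module ℝ F]
    [TopologicalSpace F] [IsTopologicalAddGroup F] [ContinuousSMul ℝ F] :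
    Submodule ℝ (U × V → F) where
  carrier := {f | IsCrs r s f}
  zero_mem' := ⟨_, hasDiffs₂_zero r s U V⟩
  add_mem' := by
    rintro _ _ ⟨D, hD⟩ ⟨D', hD'⟩
    exact ⟨_, hD.add hD'⟩
  smul_mem' := by
    rintro c _ ⟨D, hD⟩
    exact ⟨_, hD.const_smul c⟩

/-- The vector space `C^{r,s}(U × V, F)` of all `C^{r,s}`-maps `U × V → F` (pointwise
operations). -/
def CrsMap (r s : ℕ∞) (U : Set E₁) (V : Set E₂) (F : Type*) [AddCommGroup F] [Module ℝ F]
    [TopologicalSpace F] [IsTopologicalAddGroup F] [ContinuousSMul ℝ F] : Type _ :=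
  ↥(crsSubmodule r s U V F)

namespace CrsMap

variable {r s : ℕ∞} {U : Set E₁} {V : Set E₂}

instance : AddCommGroup (CrsMap r s U V F) :=
  inferInstanceAs (AddCommGroup ↥(crsSubmodule r s U V F))

instance : Module ℝ (CrsMap r s U V F) := inferInstanceAs (Module ℝ ↥(crsSubmodule r s U V F))

instance : CoeFun (CrsMap r s U V F) (fun _ => U × V → F) := ⟨fun f => Subtype.val f⟩

theorem isCrs (f : CrsMap r s U V F) : IsCrs r s (f : U × V → F) := Subtype.property f

/-- The differential `d^(i,j) f : U × V × E₁^i × E₂^j → F` of a `C^{r,s}`-map `f` (meaningful for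
`i ≤ r` and `j ≤ s`). -/
def diff (f : CrsMap r s U V F) (i j : ℕ) : U × V × (Fin i → E₁) × (Fin j → E₂) → F :=
  Classical.choose f.isCrs i j

theorem hasDiffs₂ (f : CrsMap r s U V F) : HasDiffs₂ r s (f : U × V → F) f.diff :=
  Classical.choose_spec f.isCrs

/-- The differential `d^(i,j) f`, for `i ≤ r` and `j ≤ s`, as an element of
`C(U × V × E₁^i × E₂^j, F)`. -/
def diffC (i j : ℕ) (hi : (i : ℕ∞) ≤ r) (hj : (j : ℕ∞) ≤ s) (f : CrsMap r s U V F) :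
    C(U × V × (Fin i → E₁) × (Fin j → E₂), F) :=
  ⟨f.diff i j, f.hasDiffs₂.continuous i j hi hj⟩

/-- The compact-open `C^{r,s}`-topology: the initial topology with respect to the maps
`d^(i,j) : C^{r,s}(U × V, F) → C(U × V × E₁^i × E₂^j, F)`, `i ≤ r`, `j ≤ s`, where the spaces on the
right carry the compact-open topology. -/
instance : TopologicalSpace (CrsMap r s U V F) :=
  ⨅ (i : ℕ) (j : ℕ) (hi : (i : ℕ∞) ≤ r) (hj : (j : ℕ∞) ≤ s),
    TopologicalSpace.induced (diffC i j hi hj) inferInstance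

end CrsMap

end CrsSpace

/-! ### `C^r(U, F)` is a topological vector space -/

section TVS

variable [IsTopologicalAddGroup E] [ContinuousSMul ℝ E] [T2Space F]

theorem eqOn_interior_of_hasDiffs {r : ℕ∞} {U : Set E} {f : U → F}
    {D D' : ∀ k : ℕ, U × (Fin k → E) → F} (h : HasDiffs r f D) (h' : HasDiffs r f D') (k : ℕ)
    (hk : (k : ℕ∞) ≤ r) (x : U) (hx : (x : E) ∈ interior U) (y : Fin k → E) :
    D k (x, y) = D' k (x, y) := by
  induction k generalizing x with
  | zero => rw [h.zero, h'.zero]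
  | succ k ih =>
    have hk' : (k : ℕ∞) ≤ r := le_trans (by exact_mod_cast Nat.le_succ k) hk
    refine tendsto_nhds_unique_of_eventuallyEq (h.succ k hk x hx y) (h'.succ k hk x hx y) ?_
    have hc : Continuous fun t : ℝ => (x : E) + t • y (Fin.last k) := by fun_prop
    have hmem : ∀ᶠ t : ℝ in 𝓝 0, (x : E) + t • y (Fin.last k) ∈ interior U :=
      hc.continuousAt.eventually (isOpen_interior.mem_nhds (by simpa using hx))
    filter_upwards [hmem.filter_mono nhdsWithin_le_nhds] with t ht
    have e : ∀ g : U → F, Function.extend Subtype.val g 0 ((x : E) + t • y (Fin.last k)) =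
        g ⟨_, interior_subset ht⟩ := fun g => Subtype.val_injective.extend_apply g 0 ⟨_, _⟩
    rw [e, e, ih hk' _ ht, ih hk' x hx]

/-- The differentials of a `C^r`-map are uniquely determined. -/
theorem HasDiffs.unique {r : ℕ∞} {U : Set E} [hU : IsLocConvexDenseInterior U] {f : U → F}
    {D D' : ∀ k : ℕ, U × (Fin k → E) → F} (h : HasDiffs r f D) (h' : HasDiffs r f D') (k : ℕ)
    (hk : (k : ℕ∞) ≤ r) : D k = D' k := by
  have hd : Dense {x : U | (x : E) ∈ interior U} := by
    rw [Subtype.dense_iff]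
    refine hU.denseInterior.trans (closure_mono fun x hx => ?_)
    exact ⟨⟨x, interior_subset hx⟩, hx, rfl⟩
  funext ⟨x, y⟩
  have hc : ∀ {D : ∀ k : ℕ, U × (Fin k → E) → F}, HasDiffs r f D →
      Continuous fun x : U => D k (x, y) :=
    fun h => (h.continuous k hk).comp (by fun_prop)
  exact congrFun (Continuous.ext_on hd (hc h) (hc h')
    fun x hx => eqOn_interior_of_hasDiffs h h' k hk x hx y) x

namespace CrMap

variable [IsTopologicalAddGroup F] [ContinuousSMul ℝ F] {r : ℕ∞} {U : Set E}
  [IsLocConvexDenseInterior U]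

/-- The linear map `d^(k) : C^r(U, F) → C(U × E^k, F)`. -/
def diffL (k : ℕ) (hk : (k : ℕ∞) ≤ r) : CrMap r U F →ₗ[ℝ] C(U × (Fin k → E), F) where
  toFun := diffC k hk
  map_add' f g := ContinuousMap.ext fun p =>
    congrFun ((f + g).hasDiffs.unique (f.hasDiffs.add g.hasDiffs) k hk) p
  map_smul' c f := ContinuousMap.ext fun p =>
    congrFun ((c • f).hasDiffs.unique (f.hasDiffs.const_smul c) k hk) p

instance : IsTopologicalAddGroup (CrMap r U F) :=
  topologicalAddGroup_iInf fun k => topologicalAddGroup_iInf fun hk =>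
    topologicalAddGroup_induced (diffL k hk)

instance : ContinuousSMul ℝ (CrMap r U F) :=
  continuousSMul_iInf fun k => continuousSMul_iInf fun hk =>
    continuousSMul_induced (diffL k hk)

end CrMap

end TVS

end Definitions

end

/-! For f of class C^{r,s}, the differentials of f^∨ should be (x, w) ↦ d^(i,0) f (x, ·, w), and
d^(j) of these should be d^(i,j) f. Two points need proof. Derivatives in the second variable must
be available after those in the first, and at boundary points of U too. And difference quotients
must converge in C^s(V, F), that is, after each d^(j), uniformly on compact sets. Both rest on the
mean value inclusion in F, a consequence of Hahn–Banach separation. It yields the interchange of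
derivatives (`hasCurveDeriv_of_mixed`) and difference quotients that converge locally uniformly in a
parameter, even if differentiability is known only for a dense set of parameters
(`tendsto_difference_quotient`).

Φ is a topological embedding without any of the conditions (a)–(e): both topologies are initial, one
for the maps d^(i,j), the other for their curried forms, and currying is an embedding for
compact-open topologies.

The conditions serve surjectivity. For g of class C^r, the map (x, y, w, v) ↦ d^(j)(d^(i) g (x,
w))(y, v) has the right derivatives, and only its joint continuity is at stake. Evaluation is
jointly continuous over a locally compact space; on a k-space, continuity can be tested on compact
sets. As the k-space condition involves E₁ × E₂ and not E₁^i × E₂^j, polarization first reduces each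
differential to its diagonal, which requires differentials to be symmetric and multilinear. -/

/-! ### Mean value inclusion and interchange of derivatives for curves -/

section CurveDerivative

variable {F : Type*} [AddCommGroup F] [Module ℝ F] [TopologicalSpace F]

/-- `l` is the derivative at `τ` of the curve `γ` in a real topological vector space. -/
def HasCurveDeriv (γ : ℝ → F) (τ : ℝ) (l : F) : Prop :=
  Tendsto (fun t : ℝ => t⁻¹ • (γ (τ + t) - γ τ)) (𝓝[≠] 0) (𝓝 l)

theorem HasCurveDeriv.clm_comp {γ : ℝ → F} {τ : ℝ} {l : F} (h : HasCurveDeriv γ τ l)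
    (φ : F →L[ℝ] ℝ) : HasDerivAt (fun t => φ (γ t)) (φ l) τ := by
  rw [hasDerivAt_iff_tendsto_slope_zero]
  refine ((φ.continuous.tendsto l).comp h).congr fun t => ?_
  simp

variable [IsTopologicalAddGroup F] [ContinuousSMul ℝ F]

theorem HasCurveDeriv.const_smul {γ : ℝ → F} {τ : ℝ} {l : F} (h : HasCurveDeriv γ τ l) (c : ℝ) :
    HasCurveDeriv (fun t => c • γ t) τ (c • l) :=
  (Tendsto.const_smul h c).congr fun t => by rw [← smul_sub, smul_comm]

theorem HasCurveDeriv.sub {γ γ' : ℝ → F} {τ : ℝ} {l l' : F} (h : HasCurveDeriv γ τ l)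
    (h' : HasCurveDeriv γ' τ l') : HasCurveDeriv (fun t => γ t - γ' t) τ (l - l') :=
  (Tendsto.sub h h').congr fun t => by rw [← smul_sub, sub_sub_sub_comm]

variable [LocallyConvexSpace ℝ F]

/-- The mean value inclusion: difference quotients lie in every closed convex set containing the
derivatives. -/
theorem inv_smul_sub_mem_of_hasCurveDeriv {γ γ' : ℝ → F} {C : Set F} (hC : Convex ℝ C)
    (hC' : IsClosed C) {t : ℝ} (ht : t ≠ 0)
    (hγ : ∀ σ ∈ Set.uIcc 0 t, HasCurveDeriv γ σ (γ' σ) ∧ γ' σ ∈ C) :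
    t⁻¹ • (γ t - γ 0) ∈ C := by
  by_contra hn
  -- A functional φ with φ < u on C and φ > u at the difference quotient contradicts the real mean
  -- value theorem for φ ∘ γ.
  obtain ⟨φ, u, hφ, hu⟩ := geometric_hahn_banach_closed_point hC hC' hn
  have hd : ∀ σ ∈ Set.uIcc 0 t, HasDerivAt (fun t => φ (γ t)) (φ (γ' σ)) σ :=
    fun σ hσ => (hγ σ hσ).1.clm_comp φ
  have hlt : ∀ σ ∈ Set.uIcc 0 t, φ (γ' σ) < u := fun σ hσ => hφ _ (hγ σ hσ).2
  have key : ∃ σ ∈ Set.uIcc 0 t, φ (γ' σ) = t⁻¹ * (φ (γ t) - φ (γ 0)) := by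
    rcases lt_or_gt_of_ne ht with h | h
    · rw [Set.uIcc_of_ge h.le] at hd ⊢
      obtain ⟨c, hc, e⟩ := exists_hasDerivAt_eq_slope (fun t => φ (γ t)) (fun σ => φ (γ' σ)) h
        (fun σ hσ => (hd σ hσ).continuousAt.continuousWithinAt)
        (fun σ hσ => hd σ (Set.Ioo_subset_Icc_self hσ))
      refine ⟨c, Set.Ioo_subset_Icc_self hc, e.trans ?_⟩
      field_simp
      ring
    · rw [Set.uIcc_of_le h.le] at hd ⊢
      obtain ⟨c, hc, e⟩ := exists_hasDerivAt_eq_slope (fun t => φ (γ t)) (fun σ => φ (γ' σ)) h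
        (fun σ hσ => (hd σ hσ).continuousAt.continuousWithinAt)
        (fun σ hσ => hd σ (Set.Ioo_subset_Icc_self hσ))
      refine ⟨c, Set.Ioo_subset_Icc_self hc, e.trans ?_⟩
      field_simp
      ring
  obtain ⟨σ, hσ, e⟩ := key
  have := hlt σ hσ
  rw [e] at this
  simp only [map_smul, map_sub, smul_eq_mul] at hu
  linarith

theorem exists_isClosed_convex_subset_of_mem_nhds {l : F} {N : Set F} (hN : N ∈ 𝓝 l) :
    ∃ C ∈ 𝓝 l, IsClosed C ∧ Convex ℝ C ∧ C ⊆ N := by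
  obtain ⟨N', hN', hcl, hsub⟩ := exists_mem_nhds_isClosed_subset hN
  obtain ⟨W, ⟨hW, hWc⟩, hWN⟩ := (LocallyConvexSpace.convex_basis (𝕜 := ℝ) l).mem_iff.1 hN'
  exact ⟨closure W, mem_of_superset hW subset_closure, isClosed_closure, hWc.closure,
    (closure_minimal hWN hcl).trans hsub⟩

/-- To prove convergence in a locally convex space, it suffices to consider closed convex
neighbourhoods. -/
theorem tendsto_nhds_of_isClosed_convex {α : Type*} {f : α → F} {a : Filter α} {l : F}
    (h : ∀ C ∈ 𝓝 l, IsClosed C → Convex ℝ C → ∀ᶠ x in a, f x ∈ C) : Tendsto f a (𝓝 l) := by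
  intro N hN
  obtain ⟨C, hC, hcl, hco, hsub⟩ := exists_isClosed_convex_subset_of_mem_nhds hN
  exact mem_of_superset (h C hC hcl hco) fun x hx => hsub hx

theorem Real.abs_lt_of_mem_uIcc_zero {σ t δ : ℝ} (h : σ ∈ Set.uIcc 0 t) (ht : |t| < δ) :
    |σ| < δ := by
  have := Set.abs_sub_left_of_mem_uIcc h
  simp only [sub_zero] at this
  exact this.trans_lt ht

/-- Interchange of two derivatives. -/
theorem hasCurveDeriv_of_mixed {H H₂ H₂₁ : ℝ → ℝ → F} {H₁ : ℝ → F} {l : F}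
    (h₁ : ∀ᶠ t in 𝓝 (0 : ℝ), HasCurveDeriv (fun s => H s t) 0 (H₁ t))
    (h₂ : ∀ᶠ p : ℝ × ℝ in 𝓝 (0, 0), HasCurveDeriv (H p.1) p.2 (H₂ p.1 p.2))
    (h₂₁ : ∀ᶠ p : ℝ × ℝ in 𝓝 (0, 0), HasCurveDeriv (fun s => H₂ s p.2) p.1 (H₂₁ p.1 p.2))
    (hl : Tendsto (fun p : ℝ × ℝ => H₂₁ p.1 p.2) (𝓝 (0, 0)) (𝓝 l)) :
    HasCurveDeriv H₁ 0 l := by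
  refine tendsto_nhds_of_isClosed_convex fun C hC hcl hco => ?_
  obtain ⟨δ, hδ, hb⟩ := Metric.eventually_nhds_iff.1 (h₂.and (h₂₁.and (hl.eventually hC)))
  obtain ⟨ε, hε, hb₁⟩ := Metric.eventually_nhds_iff.1 h₁
  have hb' : ∀ s t : ℝ, |s| < δ → |t| < δ → HasCurveDeriv (H s) t (H₂ s t) ∧
      HasCurveDeriv (fun s => H₂ s t) s (H₂₁ s t) ∧ H₂₁ s t ∈ C := fun s t hs ht =>
    hb (y := (s, t)) (by simp [Prod.dist_eq, hs, ht])
  have hsmall : ∀ r : ℝ, 0 < r → ∀ᶠ t in 𝓝[≠] (0 : ℝ), |t| < r := fun r hr =>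
    nhdsWithin_le_nhds (Metric.eventually_nhds_iff.2 ⟨r, hr, fun y hy => by simpa using hy⟩)
  filter_upwards [hsmall δ hδ, hsmall ε hε, self_mem_nhdsWithin] with t htδ htε ht0
  have e₁ := hb₁ (y := t) (by simpa using htε)
  have e₀ := hb₁ (y := 0) (by simpa using hε)
  -- For fixed t, the difference quotient of `H₁` is the limit as s → 0 of second-order difference
  -- quotients of `H`; as C is closed, it suffices to place those in C.
  have hlim := Tendsto.const_smul (Tendsto.sub e₁ e₀) t⁻¹
  simp only [zero_add] at hlim ⊢
  refine hcl.mem_of_tendsto hlim ?_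
  filter_upwards [hsmall δ hδ, self_mem_nhdsWithin] with s hsδ hs0
  -- Mean value inclusion in t; the derivatives it asks for are difference quotients of `H₂` in s,
  -- which lie in C by a second application.
  have := inv_smul_sub_mem_of_hasCurveDeriv (γ := fun τ => s⁻¹ • (H s τ - H 0 τ))
    (γ' := fun τ => s⁻¹ • (H₂ s τ - H₂ 0 τ)) hco hcl ht0 fun τ hτ => ?_
  · exact this
  have hτδ := Real.abs_lt_of_mem_uIcc_zero hτ htδ
  refine ⟨((hb' s τ hsδ hτδ).1.sub (hb' 0 τ (by simpa using hδ) hτδ).1).const_smul _, ?_⟩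
  exact inv_smul_sub_mem_of_hasCurveDeriv (γ := fun s => H₂ s τ)
    (γ' := fun s => H₂₁ s τ) hco hcl hs0 fun σ hσ =>
      (hb' σ τ (Real.abs_lt_of_mem_uIcc_zero hσ hsδ) hτδ).2

end CurveDerivative

/-! ### Difference quotients depending on a parameter -/

section DifferenceQuotient

variable {E F Z : Type*} [AddCommGroup E] [Module ℝ E] [TopologicalSpace E]
  [IsTopologicalAddGroup E] [ContinuousSMul ℝ E]
  [AddCommGroup F] [Module ℝ F] [TopologicalSpace F] [IsTopologicalAddGroup F]
  [ContinuousSMul ℝ F] [LocallyConvexSpace ℝ F] [TopologicalSpace Z]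

/-- Difference quotients of a function depending on a parameter converge jointly in the increment,
the base point and the parameter, if the derivative is continuous; differentiability is only needed
for a dense set of parameters. -/
theorem tendsto_difference_quotient {O : Set E} (hO : IsOpen O) {Z₀ : Set Z} (hZ₀ : Dense Z₀)
    {h dh : E → Z → F} {w : E} (hc : ∀ x ∈ O, Continuous (h x))
    (hd : ∀ x ∈ O, ∀ z ∈ Z₀, HasCurveDeriv (fun t => h (x + t • w) z) 0 (dh x z))
    {x : E} (hx : x ∈ O) {z : Z} (hdc : ContinuousAt (fun p : E × Z => dh p.1 p.2) (x, z)) :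
    Tendsto (fun p : ℝ × E × Z => p.1⁻¹ • (h (p.2.1 + p.1 • w) p.2.2 - h p.2.1 p.2.2))
      (𝓝[≠] 0 ×ˢ 𝓝 x ×ˢ 𝓝 z) (𝓝 (dh x z)) := by
  refine tendsto_nhds_of_isClosed_convex fun C hC hcl hco => ?_
  have hev := hdc.eventually hC
  rw [nhds_prod_eq] at hev
  obtain ⟨P, hP, Q, hQ, hPQ⟩ := eventually_prod_iff.1 hev
  obtain ⟨N, hN, hNo, hzN⟩ := mem_nhds_iff.1 hQ
  have hm : Continuous fun q : ℝ × E => q.2 + q.1 • w := by fun_prop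
  have hev' : ∀ᶠ q : ℝ × E in 𝓝 0 ×ˢ 𝓝 x, P (q.2 + q.1 • w) ∧ q.2 + q.1 • w ∈ O := by
    rw [← nhds_prod_eq]
    refine hm.continuousAt.eventually (p := fun y => P y ∧ y ∈ O) ?_
    simpa using And.intro hP (hO.mem_nhds hx)
  obtain ⟨A, hA, B, hB, hAB⟩ := eventually_prod_iff.1 hev'
  obtain ⟨δ, hδ, hδA⟩ := Metric.eventually_nhds_iff.1 hA
  have h1 : ∀ᶠ t : ℝ in 𝓝[≠] 0, |t| < δ ∧ t ≠ 0 :=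
    Filter.Eventually.and (Filter.Eventually.filter_mono nhdsWithin_le_nhds
      (Metric.eventually_nhds_iff.2 ⟨δ, hδ, fun y hy => by simpa using hy⟩)) self_mem_nhdsWithin
  refine (h1.prod_mk (hB.prod_mk (hNo.mem_nhds hzN))).mono ?_
  rintro ⟨t, x', z'⟩ ⟨⟨htδ, ht0⟩, hx', hz'⟩
  have hseg : ∀ σ : ℝ, |σ| < δ → P (x' + σ • w) ∧ x' + σ • w ∈ O := fun σ hσ =>
    hAB (hδA (by simpa using hσ)) hx'
  -- The mean value inclusion handles parameters in `Z₀`. The condition is closed in the parameter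
  -- and `Z₀` is dense, so it extends to all of the open set N.
  have hmem : ∀ z'' ∈ N ∩ Z₀, t⁻¹ • (h (x' + t • w) z'' - h x' z'') ∈ C := by
    rintro z'' ⟨hzn, hz0⟩
    have := inv_smul_sub_mem_of_hasCurveDeriv (γ := fun σ => h (x' + σ • w) z'')
      (γ' := fun σ => dh (x' + σ • w) z'') hco hcl ht0 fun σ hσ => ?_
    · simpa using this
    · have hs := hseg σ (Real.abs_lt_of_mem_uIcc_zero hσ htδ)
      refine ⟨?_, hPQ hs.1 (hN hzn)⟩
      refine Tendsto.congr (fun u => ?_) (hd _ hs.2 z'' hz0)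
      simp [add_smul, add_assoc]
  have hclo : IsClosed {z'' | t⁻¹ • (h (x' + t • w) z'' - h x' z'') ∈ C} := by
    refine hcl.preimage (Continuous.const_smul (Continuous.sub (hc _ (hseg t htδ).2) (hc _ ?_)) _)
    simpa using (hseg 0 (by simpa using hδ)).2
  exact closure_minimal hmem hclo (hZ₀.open_subset_closure_inter hNo hz')

end DifferenceQuotient

/-! ### Directional derivatives at interior points -/

section DirDeriv

variable {E E₁ E₂ F Z : Type*}
  [AddCommGroup E] [Module ℝ E] [TopologicalSpace E]
  [IsTopologicalAddGroup E] [ContinuousSMul ℝ E]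
  [AddCommGroup E₁] [Module ℝ E₁] [TopologicalSpace E₁]
  [IsTopologicalAddGroup E₁] [ContinuousSMul ℝ E₁]
  [AddCommGroup E₂] [Module ℝ E₂] [TopologicalSpace E₂]
  [IsTopologicalAddGroup E₂] [ContinuousSMul ℝ E₂]
  [AddCommGroup F] [Module ℝ F] [TopologicalSpace F]
  [TopologicalSpace Z]

theorem extend_val_mk {U : Set E} (g : U → F) {y : E} (hy : y ∈ U) :
    Function.extend Subtype.val g 0 y = g ⟨y, hy⟩ :=
  Subtype.val_injective.extend_apply g 0 ⟨y, hy⟩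

theorem map_val_nhds_of_mem_interior {U : Set E} {x : U} (hx : (x : E) ∈ interior U) :
    map (Subtype.val : U → E) (𝓝 x) = 𝓝 (x : E) := by
  rw [map_nhds_subtype_val, nhdsWithin_eq_nhds.2 (mem_interior_iff_mem_nhds.1 hx)]

theorem eventually_add_smul_mem_interior {U : Set E} {x : E} (hx : x ∈ interior U) (w : E) :
    ∀ᶠ t : ℝ in 𝓝 0, x + t • w ∈ interior U := by
  have hc : Continuous fun t : ℝ => x + t • w := by fun_prop
  exact hc.continuousAt.eventually (isOpen_interior.mem_nhds (by simpa using hx))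

theorem HasDirDeriv.hasCurveDeriv {U : Set E} {g : U → F} {x w : E} {s : ℝ} {l : F}
    {hs : x + s • w ∈ U} (h : HasDirDeriv g ⟨x + s • w, hs⟩ w l) :
    HasCurveDeriv (fun σ => Function.extend Subtype.val g 0 (x + σ • w)) s l := by
  refine Tendsto.congr (fun t => ?_) h
  simp only
  rw [extend_val_mk g hs, add_smul, add_assoc]

theorem hasDirDeriv_iff_hasCurveDeriv {U : Set E} {g : U → F} {x : U} {w : E} {l : F} :
    HasDirDeriv g x w l ↔
      HasCurveDeriv (fun σ => Function.extend Subtype.val g 0 ((x : E) + σ • w)) 0 l := by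
  refine tendsto_congr fun t => ?_
  simp only [zero_add, zero_smul, add_zero]
  rw [extend_val_mk g x.2]

theorem HasDirDeriv.unique [T2Space F] {U : Set E} {g : U → F} {x : U} {w : E} {l l' : F}
    (h : HasDirDeriv g x w l) (h' : HasDirDeriv g x w l') : l = l' :=
  tendsto_nhds_unique h h'

theorem HasDirDeriv.congr {U : Set E} {g g' : U → F} {x : U} {w : E} {l : F}
    (h : HasDirDeriv g x w l) (hx : (x : E) ∈ interior U)
    (e : ∀ z : U, (z : E) ∈ interior U → g z = g' z) : HasDirDeriv g' x w l := by
  refine Tendsto.congr' ?_ h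
  filter_upwards [nhdsWithin_le_nhds (eventually_add_smul_mem_interior hx w)] with t ht
  rw [extend_val_mk g (interior_subset ht), extend_val_mk g' (interior_subset ht), e _ ht, e _ hx]

/-- Continuous linear maps commute with directional derivatives. -/
theorem HasDirDeriv.clm_comp {F' : Type*} [AddCommGroup F'] [Module ℝ F'] [TopologicalSpace F']
    {U : Set E} {g : U → F} {x : U} {w : E} {l : F} (h : HasDirDeriv g x w l)
    (φ : F →ₗ[ℝ] F') (hφ : Continuous φ) : HasDirDeriv (fun z => φ (g z)) x w (φ l) := by
  refine ((hφ.tendsto l).comp h).congr fun t => ?_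
  simp only [Function.comp_apply, map_smul, map_sub]
  congr 2
  by_cases ht : (x : E) + t • w ∈ U
  · rw [extend_val_mk _ ht, extend_val_mk _ ht]
  · rw [Function.extend_apply' _ _ _ (by simpa using ht), Function.extend_apply' _ _ _
      (by simpa using ht)]
    simp

theorem HasDirDeriv.smul_direction [IsTopologicalAddGroup F] [ContinuousSMul ℝ F] {U : Set E}
    {g : U → F} {x : U} {w : E} {l : F} (h : HasDirDeriv g x w l) (c : ℝ) :
    HasDirDeriv g x (c • w) (c • l) := by
  by_cases hc : c = 0
  · subst hc
    refine (tendsto_const_nhds (x := (0 : F))).congr (fun t => ?_) |>.trans (by simp)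
    simp only [zero_smul, smul_zero, add_zero]
    rw [extend_val_mk g x.2, sub_self, smul_zero]
  · have ht : Tendsto (fun t : ℝ => t * c) (𝓝[≠] 0) (𝓝[≠] 0) := by
      refine tendsto_nhdsWithin_iff.2 ⟨?_, ?_⟩
      · have : Continuous fun t : ℝ => t * c := by fun_prop
        exact (by simpa using this.tendsto 0 : Tendsto (fun t : ℝ => t * c) (𝓝 0) (𝓝 0)).mono_left
          nhdsWithin_le_nhds
      · filter_upwards [self_mem_nhdsWithin] with t ht
        exact mul_ne_zero ht hc
    refine Tendsto.congr (fun t => ?_) (Tendsto.const_smul (Tendsto.comp h ht) c)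
    simp only [Function.comp_apply]
    rw [smul_smul, smul_smul]
    congr 1
    field_simp

theorem dense_interior_subtype {U : Set E} [hU : IsLocConvexDenseInterior U] :
    Dense {x : U | (x : E) ∈ interior U} := by
  rw [Subtype.dense_iff]
  refine hU.denseInterior.trans (closure_mono fun x hx => ?_)
  exact ⟨⟨x, interior_subset hx⟩, hx, rfl⟩

variable [IsTopologicalAddGroup F] [ContinuousSMul ℝ F] [LocallyConvexSpace ℝ F]

/-- Joint convergence of the difference quotients of a map which depends on a parameter. -/
theorem tendsto_difference_quotient_extend {U : Set E} {Z₀ : Set Z} (hZ₀ : Dense Z₀)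
    {h dh : U × Z → F} {w : E} (hc : Continuous h) (hdc : Continuous dh)
    (hd : ∀ x : U, (x : E) ∈ interior U → ∀ z ∈ Z₀,
      HasDirDeriv (fun u => h (u, z)) x w (dh (x, z)))
    {x : U} (hx : (x : E) ∈ interior U) (z : Z) :
    Tendsto (fun p : ℝ × E × Z => p.1⁻¹ •
      (Function.extend Subtype.val (fun u => h (u, p.2.2)) 0 (p.2.1 + p.1 • w) -
        Function.extend Subtype.val (fun u => h (u, p.2.2)) 0 p.2.1))
      (𝓝[≠] 0 ×ˢ 𝓝 (x : E) ×ˢ 𝓝 z) (𝓝 (dh (x, z))) := by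
  have key := tendsto_difference_quotient (isOpen_interior (s := U)) hZ₀
    (h := fun y z => Function.extend Subtype.val (fun u => h (u, z)) 0 y)
    (dh := fun y z => Function.extend Subtype.val (fun u => dh (u, z)) 0 y) (w := w)
    (fun y hy => ?_) (fun y hy z hz => ?_) hx (z := z) ?_
  · simpa only [extend_val_mk _ x.2] using key
  · have e : (fun z => Function.extend Subtype.val (fun u => h (u, z)) 0 y) =
        fun z => h (⟨y, interior_subset hy⟩, z) := funext fun z => extend_val_mk _ _
    simp only [e]
    fun_prop
  · rw [extend_val_mk _ (interior_subset hy)]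
    have := hasDirDeriv_iff_hasCurveDeriv.1 (hd ⟨y, interior_subset hy⟩ hy z hz)
    exact this
  · unfold ContinuousAt
    rw [nhds_prod_eq, ← map_val_nhds_of_mem_interior hx,
      ← Filter.map_id (f := 𝓝 z), Filter.prod_map_map_eq, tendsto_map'_iff]
    refine Tendsto.congr (f₁ := dh) (fun p => ?_) ?_
    · exact (extend_val_mk (fun u => dh (u, p.2)) p.1.2).symm
    · simp only [extend_val_mk _ x.2]
      rw [← nhds_prod_eq]
      exact hdc.tendsto (x, z)

/-- Convergence jointly in the increment and the parameter is what the compact-open topology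
requires of the difference quotients of f^∨. -/
theorem HasDirDeriv.tendsto_of_dense {U : Set E} {Z₀ : Set Z} (hZ₀ : Dense Z₀)
    {h dh : U × Z → F} {w : E} (hc : Continuous h) (hdc : Continuous dh)
    (hd : ∀ x : U, (x : E) ∈ interior U → ∀ z ∈ Z₀,
      HasDirDeriv (fun u => h (u, z)) x w (dh (x, z)))
    {x : U} (hx : (x : E) ∈ interior U) (z : Z) :
    Tendsto (fun p : ℝ × Z => p.1⁻¹ •
      (Function.extend Subtype.val (fun u => h (u, p.2)) 0 ((x : E) + p.1 • w) - h (x, p.2)))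
      (𝓝[≠] 0 ×ˢ 𝓝 z) (𝓝 (dh (x, z))) := by
  have hm : Tendsto (fun p : ℝ × Z => (p.1, (x : E), p.2)) (𝓝[≠] 0 ×ˢ 𝓝 z)
      (𝓝[≠] 0 ×ˢ 𝓝 (x : E) ×ˢ 𝓝 z) :=
    tendsto_fst.prodMk (tendsto_const_nhds.prodMk tendsto_snd)
  refine ((tendsto_difference_quotient_extend hZ₀ hc hdc hd hx z).comp hm).congr fun p => ?_
  simp only [Function.comp_apply]
  rw [extend_val_mk _ x.2]

/-- Differentiability for a dense set of parameters implies differentiability for all of them. -/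
theorem HasDirDeriv.of_dense {U : Set E} {Z₀ : Set Z} (hZ₀ : Dense Z₀)
    {h dh : U × Z → F} {w : E} (hc : Continuous h) (hdc : Continuous dh)
    (hd : ∀ x : U, (x : E) ∈ interior U → ∀ z ∈ Z₀,
      HasDirDeriv (fun u => h (u, z)) x w (dh (x, z)))
    {x : U} (hx : (x : E) ∈ interior U) (z : Z) :
    HasDirDeriv (fun u => h (u, z)) x w (dh (x, z)) :=
  (HasDirDeriv.tendsto_of_dense hZ₀ hc hdc hd hx z).comp
    (tendsto_id.prodMk (tendsto_const_nhds (x := z)))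

/-- The directional derivatives of a `C¹`-map are additive in the direction. -/
theorem HasDirDeriv.add_direction {U : Set E} {h dh : U → F} {w w' : E} {l : F}
    (hc : Continuous h) (hdc : Continuous dh)
    (hd : ∀ x : U, (x : E) ∈ interior U → HasDirDeriv h x w (dh x))
    {x : U} (hx : (x : E) ∈ interior U) (hl : HasDirDeriv h x w' l) :
    HasDirDeriv h x (w + w') (dh x + l) := by
  have key := tendsto_difference_quotient_extend (dense_univ (X := Unit))
    (h := fun p => h p.1) (dh := fun p => dh p.1) (w := w) (by fun_prop) (by fun_prop)
    (fun x hx _ _ => hd x hx) hx ()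
  -- The quotient along w + w' is the one along w at the moving base point x + t w' plus the one
  -- along w' at x; the former converges by joint convergence in the base point.
  have hm : Tendsto (fun t : ℝ => (t, (x : E) + t • w', ())) (𝓝[≠] 0)
      (𝓝[≠] 0 ×ˢ 𝓝 (x : E) ×ˢ 𝓝 ()) := by
    refine tendsto_id.prodMk (Tendsto.prodMk ?_ tendsto_const_nhds)
    have hc : Continuous fun t : ℝ => (x : E) + t • w' := by fun_prop
    exact (by simpa using hc.tendsto 0 : Tendsto (fun t : ℝ => (x : E) + t • w') (𝓝 0)
      (𝓝 (x : E))).mono_left nhdsWithin_le_nhds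
  refine ((key.comp hm).add hl).congr fun t => ?_
  simp only [Function.comp_apply]
  rw [← smul_add, sub_add_sub_cancel, smul_add, add_right_comm, add_assoc _ (t • w) (t • w')]

/-- Interchange of the directional derivatives of a function of one variable. -/
theorem HasDirDeriv.of_mixed {U : Set E} {h h₁ h₂ h₂₁ : U → F} {a b : E}
    (hc : Continuous h₂₁)
    (hh₁ : ∀ x : U, (x : E) ∈ interior U → HasDirDeriv h x a (h₁ x))
    (hh₂ : ∀ x : U, (x : E) ∈ interior U → HasDirDeriv h x b (h₂ x))
    (hh₂₁ : ∀ x : U, (x : E) ∈ interior U → HasDirDeriv h₂ x a (h₂₁ x))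
    {x : U} (hx : (x : E) ∈ interior U) : HasDirDeriv h₁ x b (h₂₁ x) := by
  rw [hasDirDeriv_iff_hasCurveDeriv]
  have hm : Continuous fun p : ℝ × ℝ => (x : E) + p.1 • a + p.2 • b := by fun_prop
  have hev : ∀ᶠ p : ℝ × ℝ in 𝓝 (0, 0), (x : E) + p.1 • a + p.2 • b ∈ interior U :=
    hm.continuousAt.eventually (isOpen_interior.mem_nhds (by simpa using hx))
  refine hasCurveDeriv_of_mixed
    (H := fun s t => Function.extend Subtype.val h 0 ((x : E) + s • a + t • b))
    (H₂ := fun s t => Function.extend Subtype.val h₂ 0 ((x : E) + s • a + t • b))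
    (H₂₁ := fun s t => Function.extend Subtype.val h₂₁ 0 ((x : E) + s • a + t • b)) ?_ ?_ ?_ ?_
  · filter_upwards [eventually_add_smul_mem_interior hx b] with t ht
    rw [extend_val_mk _ (interior_subset ht)]
    simp only [add_right_comm _ _ (t • b)]
    have := hasDirDeriv_iff_hasCurveDeriv.1 (hh₁ ⟨_, interior_subset ht⟩ ht)
    exact this
  · filter_upwards [hev] with p hp
    rw [extend_val_mk _ (interior_subset hp)]
    exact HasDirDeriv.hasCurveDeriv (hh₂ ⟨_, interior_subset hp⟩ hp)
  · filter_upwards [hev] with p hp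
    rw [extend_val_mk _ (interior_subset hp)]
    simp only [add_right_comm _ _ (p.2 • b)] at hp ⊢
    exact HasDirDeriv.hasCurveDeriv (hh₂₁ ⟨_, interior_subset hp⟩ hp)
  · have hm0 : Tendsto (fun p : ℝ × ℝ => (x : E) + p.1 • a + p.2 • b) (𝓝 (0, 0)) (𝓝 (x : E)) := by
      simpa using hm.tendsto (0, 0)
    refine Tendsto.comp (g := Function.extend Subtype.val h₂₁ 0) (y := 𝓝 (x : E)) ?_ hm0
    rw [← map_val_nhds_of_mem_interior hx, tendsto_map'_iff]
    refine Tendsto.congr (fun u => ?_) (hc.tendsto x)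
    exact (extend_val_mk h₂₁ u.2).symm

/-- Interchange of the partial directional derivatives of a function of two variables. -/
theorem HasDirDeriv.of_mixed_prod {U : Set E₁} {V : Set E₂} {h h₁ h₂ h₂₁ : U × V → F} {a : E₁}
    {b : E₂} (hc : Continuous h₂₁)
    (hh₁ : ∀ (x : U) (y : V), (x : E₁) ∈ interior U → (y : E₂) ∈ interior V →
      HasDirDeriv (fun u => h (u, y)) x a (h₁ (x, y)))
    (hh₂ : ∀ (x : U) (y : V), (x : E₁) ∈ interior U → (y : E₂) ∈ interior V →
      HasDirDeriv (fun v => h (x, v)) y b (h₂ (x, y)))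
    (hh₂₁ : ∀ (x : U) (y : V), (x : E₁) ∈ interior U → (y : E₂) ∈ interior V →
      HasDirDeriv (fun u => h₂ (u, y)) x a (h₂₁ (x, y)))
    {x : U} {y : V} (hx : (x : E₁) ∈ interior U) (hy : (y : E₂) ∈ interior V) :
    HasDirDeriv (fun v => h₁ (x, v)) y b (h₂₁ (x, y)) := by
  rw [hasDirDeriv_iff_hasCurveDeriv]
  have hU := eventually_add_smul_mem_interior hx a
  have hV := eventually_add_smul_mem_interior hy b
  have hev := hU.prod_nhds hV
  -- Extension by zero in each variable separately; it becomes an extension in one variable once the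
  -- other argument lies in its domain.
  let ext₂ : (U × V → F) → ℝ → ℝ → F := fun g s t => Function.extend Subtype.val
    (fun u => Function.extend Subtype.val (fun v => g (u, v)) 0 ((y : E₂) + t • b)) 0
    ((x : E₁) + s • a)
  have e₁ : ∀ (g : U × V → F) {t : ℝ} (ht : (y : E₂) + t • b ∈ V) (s : ℝ), ext₂ g s t =
      Function.extend Subtype.val (fun u => g (u, ⟨_, ht⟩)) 0 ((x : E₁) + s • a) := by
    intro g t ht s
    simp only [ext₂, extend_val_mk _ ht]
  have e₂ : ∀ (g : U × V → F) {s : ℝ} (hs : (x : E₁) + s • a ∈ U) (t : ℝ), ext₂ g s t =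
      Function.extend Subtype.val (fun v => g (⟨_, hs⟩, v)) 0 ((y : E₂) + t • b) := by
    intro g s hs t
    simp only [ext₂, extend_val_mk _ hs]
  refine hasCurveDeriv_of_mixed (H := ext₂ h) (H₂ := ext₂ h₂) (H₂₁ := ext₂ h₂₁) ?_ ?_ ?_ ?_
  · filter_upwards [hV] with t ht
    rw [extend_val_mk _ (interior_subset ht)]
    simp only [e₁ h (interior_subset ht)]
    have := hasDirDeriv_iff_hasCurveDeriv.1 (hh₁ x ⟨_, interior_subset ht⟩ hx ht)
    exact this
  · filter_upwards [hev] with p hp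
    have e : ext₂ h p.1 = _ := funext (e₂ h (interior_subset hp.1))
    rw [e, e₂ h₂ (interior_subset hp.1), extend_val_mk _ (interior_subset hp.2)]
    exact HasDirDeriv.hasCurveDeriv (hh₂ ⟨_, interior_subset hp.1⟩ ⟨_, interior_subset hp.2⟩
      hp.1 hp.2)
  · filter_upwards [hev] with p hp
    simp only [e₁ _ (interior_subset hp.2)]
    rw [extend_val_mk _ (interior_subset hp.1)]
    exact HasDirDeriv.hasCurveDeriv (hh₂₁ ⟨_, interior_subset hp.1⟩ ⟨_, interior_subset hp.2⟩
      hp.1 hp.2)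
  · have hm0 : Tendsto (fun p : ℝ × ℝ => ((x : E₁) + p.1 • a, (y : E₂) + p.2 • b)) (𝓝 (0, 0))
        (𝓝 (x : E₁) ×ˢ 𝓝 (y : E₂)) := by
      have hm : Continuous fun p : ℝ × ℝ => ((x : E₁) + p.1 • a, (y : E₂) + p.2 • b) := by fun_prop
      simpa [nhds_prod_eq] using hm.tendsto (0, 0)
    refine Tendsto.comp (g := fun q : E₁ × E₂ => Function.extend Subtype.val
      (fun u => Function.extend Subtype.val (fun v => h₂₁ (u, v)) 0 q.2) 0 q.1) ?_ hm0
    rw [← map_val_nhds_of_mem_interior hx,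
      ← map_val_nhds_of_mem_interior hy, Filter.prod_map_map_eq,
      tendsto_map'_iff, ← nhds_prod_eq]
    refine Tendsto.congr (fun u => ?_) (hc.tendsto (x, y))
    simp only [Function.comp_apply]
    rw [extend_val_mk _ u.1.2, extend_val_mk _ u.2.2]

end DirDeriv

/-! ### Polarization, multilinearity and symmetry of differentials -/

/-- The polarization identity for symmetric multilinear maps. -/
theorem MultilinearMap.polarization {ι E F : Type*} [Fintype ι] [DecidableEq ι]
    [AddCommGroup E] [Module ℝ E] [AddCommGroup F] [Module ℝ F]
    (m : MultilinearMap ℝ (fun _ : ι => E) F)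
    (hm : ∀ (σ : Equiv.Perm ι) (w : ι → E), m (fun i => w (σ i)) = m w) (w : ι → E) :
    ∑ T : Finset ι, (-1 : ℤ) ^ T.card • m (fun _ => ∑ i ∈ Tᶜ, w i) =
      (Fintype.card ι).factorial • m w := by
  -- Multilinear expansion: the terms are the ρ : ι → ι whose image avoids T.
  have h1 : ∀ T : Finset ι, m (fun _ => ∑ i ∈ Tᶜ, w i) =
      ∑ ρ : ι → ι, if T ⊆ (Finset.univ.image ρ)ᶜ then m (fun i => w (ρ i)) else 0 := by
    intro T
    rw [m.map_sum_finset (fun _ i => w i) (fun _ => Tᶜ), ← Finset.sum_filter]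
    refine Finset.sum_congr ?_ fun _ _ => rfl
    ext ρ
    simp only [Fintype.mem_piFinset, Finset.mem_filter, Finset.mem_univ, true_and,
      Finset.subset_iff, Finset.mem_compl, Finset.mem_image, not_exists]
    exact ⟨fun h j hj i e => h i (e ▸ hj), fun h i hi => h hi i rfl⟩
  simp only [h1, Finset.smul_sum]
  rw [Finset.sum_comm]
  -- The signs of the subsets of the complement of the image of ρ cancel unless this complement is
  -- empty, i.e. ρ is a permutation; then symmetry gives m w.
  have h2 : ∀ ρ : ι → ι, (∑ T : Finset ι, (-1 : ℤ) ^ T.card •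
      if T ⊆ (Finset.univ.image ρ)ᶜ then m (fun i => w (ρ i)) else 0) =
      if Function.Bijective ρ then m w else 0 := by
    intro ρ
    simp only [smul_ite, smul_zero]
    rw [← Finset.sum_filter, ← Finset.sum_smul]
    have e : (Finset.univ.filter fun T : Finset ι => T ⊆ (Finset.univ.image ρ)ᶜ) =
        (Finset.univ.image ρ)ᶜ.powerset := by
      ext T
      simp
    rw [e, Finset.sum_powerset_neg_one_pow_card]
    have hb : (Finset.univ.image ρ)ᶜ = ∅ ↔ Function.Bijective ρ := by
      rw [Finset.compl_eq_empty_iff, ← Finite.surjective_iff_bijective,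
        ← Finset.coe_eq_univ, Finset.coe_image, Finset.coe_univ, Set.image_univ,
        Set.range_eq_univ]
    simp only [hb]
    split_ifs with h
    · rw [one_smul]
      exact hm (Equiv.ofBijective ρ h) w
    · rw [zero_smul]
  simp only [h2]
  rw [← Finset.sum_filter, Finset.sum_const]
  congr 1
  rw [← Fintype.card_perm, ← Fintype.card_subtype]
  exact Fintype.card_congr
    { toFun := fun ρ => Equiv.ofBijective ρ.1 ρ.2
      invFun := fun σ => ⟨σ, σ.bijective⟩
      left_inv := fun _ => rfl
      right_inv := fun _ => Equiv.ext fun _ => rfl }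

section Multilinear

variable {E F : Type*} [AddCommGroup E] [Module ℝ E] [TopologicalSpace E]
  [IsTopologicalAddGroup E] [ContinuousSMul ℝ E]
  [AddCommGroup F] [Module ℝ F] [TopologicalSpace F] [IsTopologicalAddGroup F]
  [ContinuousSMul ℝ F] [LocallyConvexSpace ℝ F] [T2Space F]
  {r : ℕ∞} {U : Set E} {f : U → F} {D : ∀ k : ℕ, U × (Fin k → E) → F}

theorem natCast_le_of_succ_le {k : ℕ} {r : ℕ∞} (hk : ((k + 1 : ℕ) : ℕ∞) ≤ r) : (k : ℕ∞) ≤ r :=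
  le_trans (by exact_mod_cast Nat.le_succ k) hk

theorem HasDiffs.continuous_left (h : HasDiffs r f D) {k : ℕ} (hk : (k : ℕ∞) ≤ r)
    (y : Fin k → E) : Continuous fun z : U => D k (z, y) :=
  (h.continuous k hk).comp (by fun_prop)

theorem HasDiffs.hasDirDeriv_update_last (h : HasDiffs r f D) {k : ℕ}
    (hk : ((k + 1 : ℕ) : ℕ∞) ≤ r) {x : U} (hx : (x : E) ∈ interior U) (y : Fin (k + 1) → E)
    (c : E) : HasDirDeriv (fun z : U => D k (z, Fin.init y)) x c
      (D (k + 1) (x, Function.update y (Fin.last k) c)) := by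
  simpa using h.succ k hk x hx (Function.update y (Fin.last k) c)

theorem HasDiffs.hasDirDeriv_update_castSucc (h : HasDiffs r f D) {k : ℕ}
    (hk : ((k + 1 : ℕ) : ℕ∞) ≤ r) {x : U} (hx : (x : E) ∈ interior U) (y : Fin (k + 1) → E)
    (i : Fin k) (c : E) :
    HasDirDeriv (fun z : U => D k (z, Function.update (Fin.init y) i c)) x (y (Fin.last k))
      (D (k + 1) (x, Function.update y i.castSucc c)) := by
  simpa [(Fin.castSucc_lt_last i).ne'] using h.succ k hk x hx (Function.update y i.castSucc c)

/-- The last slot is the direction of differentiation, where `HasDirDeriv.add_direction` applies; in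
the other slots, the identity for k is differentiated. -/
theorem HasDiffs.update_add (h : HasDiffs r f D) (k : ℕ) (hk : (k : ℕ∞) ≤ r) (x : U)
    (hx : (x : E) ∈ interior U) (y : Fin k → E) (i : Fin k) (a b : E) :
    D k (x, Function.update y i (a + b)) =
      D k (x, Function.update y i a) + D k (x, Function.update y i b) := by
  induction k generalizing x with
  | zero => exact i.elim0
  | succ k ih =>
    have hk' := natCast_le_of_succ_le hk
    induction i using Fin.lastCases with
    | last =>
      exact (h.hasDirDeriv_update_last hk hx y (a + b)).unique
        (HasDirDeriv.add_direction (dh := fun z => D (k + 1) (z, Function.update y (Fin.last k) a))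
          (h.continuous_left hk' _) (h.continuous_left hk _)
          (fun z hz => h.hasDirDeriv_update_last hk hz y a) hx (h.hasDirDeriv_update_last hk hx y b))
    | cast i =>
      refine (h.hasDirDeriv_update_castSucc hk hx y i (a + b)).unique ?_
      refine ((h.hasDirDeriv_update_castSucc hk hx y i a).add
        (h.hasDirDeriv_update_castSucc hk hx y i b)).congr hx fun z hz => ?_
      exact (ih hk' z hz _ i).symm

theorem HasDiffs.update_smul (h : HasDiffs r f D) (k : ℕ) (hk : (k : ℕ∞) ≤ r) (x : U)
    (hx : (x : E) ∈ interior U) (y : Fin k → E) (i : Fin k) (c : ℝ) (a : E) :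
    D k (x, Function.update y i (c • a)) = c • D k (x, Function.update y i a) := by
  induction k generalizing x with
  | zero => exact i.elim0
  | succ k ih =>
    have hk' := natCast_le_of_succ_le hk
    induction i using Fin.lastCases with
    | last =>
      exact (h.hasDirDeriv_update_last hk hx y (c • a)).unique
        ((h.hasDirDeriv_update_last hk hx y a).smul_direction c)
    | cast i =>
      refine (h.hasDirDeriv_update_castSucc hk hx y i (c • a)).unique ?_
      refine ((h.hasDirDeriv_update_castSucc hk hx y i a).const_smul c).congr hx fun z hz => ?_
      exact (ih hk' z hz _ i).symm

/-- Exchanging the last two slots interchanges two directional derivatives of d^(k-1). An exchange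
of earlier slots is inherited by differentiating the identity one order below. -/
theorem HasDiffs.comp_swap (h : HasDiffs r f D) (k : ℕ) (hk : ((k + 1 : ℕ) : ℕ∞) ≤ r) (i : Fin k)
    (x : U) (hx : (x : E) ∈ interior U) (y : Fin (k + 1) → E) :
    D (k + 1) (x, fun j => y (Equiv.swap i.castSucc i.succ j)) = D (k + 1) (x, y) := by
  induction k generalizing x with
  | zero => exact i.elim0
  | succ k ih =>
    have hk' := natCast_le_of_succ_le hk
    set y' : Fin (k + 1 + 1) → E := fun j => y (Equiv.swap i.castSucc i.succ j) with hy'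
    induction i using Fin.lastCases with
    | last =>
      have e0 : Fin.init (Fin.init y') = Fin.init (Fin.init y) := by
        funext j
        simp only [Fin.init, hy']
        rw [Equiv.swap_apply_of_ne_of_ne]
        · intro e
          have := congrArg Fin.val e
          simp at this
          omega
        · intro e
          have := congrArg Fin.val e
          simp at this
          omega
      have e1 : Fin.init y' (Fin.last k) = y (Fin.last (k + 1)) := by
        simp [Fin.init, hy']
      have e2 : y' (Fin.last (k + 1)) = Fin.init y (Fin.last k) := by
        simp [Fin.init, hy', ← Fin.succ_last]
      refine HasDirDeriv.unique (HasDirDeriv.of_mixed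
        (h := fun z : U => D k (z, Fin.init (Fin.init y)))
        (h₁ := fun z : U => D (k + 1) (z, Fin.init y))
        (h₂ := fun z : U => D (k + 1) (z, Fin.init y'))
        (h₂₁ := fun z : U => D (k + 1 + 1) (z, y')) (a := Fin.init y (Fin.last k))
        (b := y (Fin.last (k + 1))) (h.continuous_left hk _)
        (fun z hz => h.succ k hk' z hz _) (fun z hz => ?_) (fun z hz => ?_) hx)
        (h.succ (k + 1) hk x hx y)
      · have := h.succ k hk' z hz (Fin.init y')
        rwa [e0, e1] at this
      · have := h.succ (k + 1) hk z hz y'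
        rwa [e2] at this
    | cast i =>
      have e0 : Fin.init y' = fun j => Fin.init y (Equiv.swap i.castSucc i.succ j) := by
        funext j
        simp only [Fin.init, hy']
        rw [← Fin.castSucc_succ]
        congr 1
        exact (Fin.castSucc_injective _).swap_apply _ _ _
      have e2 : y' (Fin.last (k + 1)) = y (Fin.last (k + 1)) := by
        simp only [hy']
        rw [Equiv.swap_apply_of_ne_of_ne]
        · exact (Fin.castSucc_lt_last _).ne'
        · rw [Fin.succ_castSucc]
          exact (Fin.castSucc_lt_last _).ne'
      have h1 := h.succ (k + 1) hk x hx y'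
      rw [e0, e2] at h1
      exact (h1.congr hx fun z hz => ih hk' i z hz _).unique (h.succ (k + 1) hk x hx y)

theorem HasDiffs.comp_perm (h : HasDiffs r f D) (k : ℕ) (hk : (k : ℕ∞) ≤ r)
    (x : U) (hx : (x : E) ∈ interior U) (σ : Equiv.Perm (Fin k)) (y : Fin k → E) :
    D k (x, fun j => y (σ j)) = D k (x, y) := by
  cases k with
  | zero =>
    congr 2
    exact Subsingleton.elim _ _
  | succ k =>
    -- Adjacent transpositions generate the symmetric group.
    have hσ : σ ∈ Submonoid.closure
        (Set.range fun i : Fin k => Equiv.swap i.castSucc i.succ) := by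
      rw [Equiv.Perm.mclosure_swap_castSucc_succ]
      trivial
    induction hσ using Submonoid.closure_induction generalizing y with
    | mem σ hσ =>
      obtain ⟨i, rfl⟩ := hσ
      exact h.comp_swap k hk i x hx y
    | one => rfl
    | mul σ τ _ _ ihσ ihτ =>
      exact (ihτ fun j => y (σ j)).trans (ihσ y)

/-- The differentials of a `C^r`-map are determined by their values on the diagonal. -/
theorem HasDiffs.polarization [IsLocConvexDenseInterior U] (h : HasDiffs r f D) (k : ℕ)
    (hk : (k : ℕ∞) ≤ r) (x : U) (y : Fin k → E) :
    D k (x, y) = ((k.factorial : ℝ)⁻¹) • ∑ T : Finset (Fin k),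
      (-1 : ℤ) ^ T.card • D k (x, fun _ => ∑ i ∈ Tᶜ, y i) := by
  -- Both sides are continuous in x, so interior points suffice, where d^(k) f is symmetric and
  -- multilinear.
  refine congrFun (Continuous.ext_on (f := fun x : U => D k (x, y))
    (g := fun x : U => ((k.factorial : ℝ)⁻¹) • ∑ T : Finset (Fin k),
      (-1 : ℤ) ^ T.card • D k (x, fun _ => ∑ i ∈ Tᶜ, y i)) dense_interior_subtype
    (h.continuous_left hk y) (Continuous.const_smul (continuous_finsetSum _ fun T _ =>
      (h.continuous_left hk _).zsmul _) _) fun x hx => ?_) x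
  let m : MultilinearMap ℝ (fun _ : Fin k => E) F :=
    { toFun := fun y => D k (x, y)
      map_update_add' := fun y i a b => by
        convert h.update_add k hk x hx y i a b
      map_update_smul' := fun y i c a => by
        convert h.update_smul k hk x hx y i c a }
  have := m.polarization (fun σ w => h.comp_perm k hk x hx σ w) y
  simp only [m, MultilinearMap.coe_mk, Fintype.card_fin] at this
  simp only
  rw [this, ← Nat.cast_smul_eq_nsmul ℝ, smul_smul, inv_mul_cancel₀, one_smul]
  exact_mod_cast k.factorial_ne_zero

end Multilinear

/-! ### Compact-open topology, currying and k-spaces -/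

section CompactOpen

variable {X Y W Z A G F : Type*} [TopologicalSpace X] [TopologicalSpace Y] [TopologicalSpace W]
  [TopologicalSpace A]

/-- Locally uniform convergence implies convergence in the compact-open topology. -/
theorem ContinuousMap.tendsto_of_tendsto_prod [TopologicalSpace Z] {α : Type*} {l : Filter α}
    {u : α → C(X, Z)} {g : C(X, Z)}
    (h : ∀ x, Tendsto (fun p : α × X => u p.1 p.2) (l ×ˢ 𝓝 x) (𝓝 (g x))) :
    Tendsto u l (𝓝 g) := by
  rw [ContinuousMap.tendsto_nhds_compactOpen]
  intro K hK O hO hg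
  have : ∀ x ∈ K, ∀ᶠ p : α × X in l ×ˢ 𝓝 x, u p.1 p.2 ∈ O :=
    fun x hx => (h x).eventually (hO.mem_nhds (hg hx))
  have := hK.mem_prod_nhdsSet_of_forall (s := {p : α × X | u p.1 p.2 ∈ O}) (l := l) this
  obtain ⟨P, hP, Q, hQ, hPQ⟩ := eventually_prod_iff.1 this
  exact hP.mono fun a ha x hx => hPQ ha (hQ.self_of_nhdsSet x hx)

/-- A map into `C(X, G)`, where `G` carries an initial topology with respect to maps into uniform
spaces, is continuous if its compositions with these maps are so. -/
theorem ContinuousMap.continuous_of_continuous_postcomp {J : Type*} {Z : J → Type*}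
    [∀ j, UniformSpace (Z j)] [t : TopologicalSpace G] (φ : ∀ j, G → Z j)
    (hφ : ∀ j, Continuous (φ j))
    (hG : t = ⨅ j, TopologicalSpace.induced (φ j) inferInstance) {Ψ : A → C(X, G)}
    (h : ∀ j, Continuous fun a => (⟨φ j, hφ j⟩ : C(G, Z j)).comp (Ψ a)) : Continuous Ψ := by
  -- The initial uniformity induces the given topology, and the compact-open topology is uniform
  -- convergence on compact sets, which can be checked after each `φ j`.
  let u₀ : UniformSpace G := ⨅ j, UniformSpace.comap (φ j) inferInstance
  have hu : t = u₀.toTopologicalSpace := by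
    rw [hG, UniformSpace.toTopologicalSpace_iInf]
    rfl
  subst hu
  rw [continuous_iff_continuousAt]
  intro a
  unfold ContinuousAt
  rw [ContinuousMap.tendsto_iff_forall_isCompact_tendstoUniformlyOn]
  intro K hK
  rw [tendstoUniformlyOn_iff_tendsto, iInf_uniformity, tendsto_iInf]
  intro j
  have hj := (h j).tendsto a
  rw [ContinuousMap.tendsto_iff_forall_isCompact_tendstoUniformlyOn] at hj
  have hj := hj K hK
  rw [tendstoUniformlyOn_iff_tendsto] at hj
  exact tendsto_comap_iff.2 hj

/-- Currying is a topological embedding of `C(X × Y, Z)` in `C(X, C(Y, Z))`. -/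
theorem ContinuousMap.continuous_of_continuous_curry [UniformSpace Z] {Ψ : A → C(X × Y, Z)}
    (h : Continuous fun a => (Ψ a).curry) : Continuous Ψ := by
  rw [continuous_iff_continuousAt]
  intro a
  unfold ContinuousAt
  rw [ContinuousMap.tendsto_iff_forall_isCompact_tendstoUniformlyOn]
  intro K hK N hN
  have ha := h.tendsto a
  rw [ContinuousMap.tendsto_iff_forall_isCompact_tendstoUniformlyOn] at ha
  -- K lies in the product of its two compact projections, over which closeness of the curried maps
  -- is uniform.
  have hK₁ := hK.image continuous_fst
  have hK₂ := hK.image continuous_snd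
  have := ha _ hK₁ _ ((ContinuousMap.mem_compactConvergence_entourage_iff _).2
    ⟨_, N, hK₂, hN, subset_rfl⟩)
  filter_upwards [this] with b hb p hp
  exact hb p.1 ⟨p, hp, rfl⟩ p.2 ⟨p, hp, rfl⟩

/-- The composition of currying with a change of variables is continuous. -/
theorem ContinuousMap.continuous_curry_comp [UniformSpace Z] (e : C(X × Y, W)) :
    Continuous fun f : C(W, Z) => (f.comp e).curry := by
  rw [continuous_iff_continuousAt]
  intro f
  unfold ContinuousAt
  rw [ContinuousMap.tendsto_iff_forall_isCompact_tendstoUniformlyOn]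
  intro K hK N hN
  obtain ⟨K', N', hK', hN', hs⟩ := (ContinuousMap.mem_compactConvergence_entourage_iff _).1 hN
  have hf := (tendsto_id (x := 𝓝 f))
  rw [ContinuousMap.tendsto_iff_forall_isCompact_tendstoUniformlyOn] at hf
  filter_upwards [hf _ ((hK.prod hK').image e.continuous) N' hN'] with g hg x hx
  exact hs fun y hy => hg _ ⟨(x, y), ⟨hx, hy⟩, rfl⟩

/-- Continuity of an uncurried map on a k-space. -/
theorem IsKSpace.continuous_uncurry [TopologicalSpace Z] (hW : IsKSpace W) [T2Space Y]
    {h : X → C(Y, Z)} (hc : Continuous h) {a : W → X} {b : W → Y} (ha : Continuous a)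
    (hb : Continuous b) : Continuous fun w => h (a w) (b w) := by
  have := hW.coherent
  rw [(CompactlyCoherentSpace.isCoherentWith (X := W)).continuous_iff]
  intro K hK
  -- Over K only the restrictions of the maps h (a w) to the compact Hausdorff space b(K) matter,
  -- and there evaluation is jointly continuous.
  have hbK : IsCompact (b '' K) := hK.image hb
  have : CompactSpace (b '' K) := isCompact_iff_compactSpace.1 hbK
  rw [continuousOn_iff_continuous_domRestrict]
  have h1 : Continuous fun w : K => (h (a w)).restrict (b '' K) :=
    (ContinuousMap.continuous_restrict (b '' K)).comp (hc.comp (ha.comp continuous_subtype_val))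
  have h2 : Continuous fun w : K => (⟨b w, w, w.2, rfl⟩ : b '' K) :=
    (hb.comp continuous_subtype_val).subtype_mk _
  exact h1.eval h2

end CompactOpen

/-! ### The topology of C^r(U, F) -/

section CrMapTopology

variable {E F A : Type*} [AddCommGroup E] [Module ℝ E] [TopologicalSpace E]
  [AddCommGroup F] [Module ℝ F] [TopologicalSpace F] [IsTopologicalAddGroup F]
  [ContinuousSMul ℝ F] {r : ℕ∞} {U : Set E}

theorem CrMap.ext {f g : CrMap r U F} (h : ∀ x, f x = g x) : f = g :=
  Subtype.ext (funext h)

theorem CrMap.continuous_diffC (k : ℕ) (hk : (k : ℕ∞) ≤ r) :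
    Continuous (CrMap.diffC k hk : CrMap r U F → C(U × (Fin k → E), F)) :=
  continuous_iff_le_induced.2 (iInf₂_le k hk)

theorem CrMap.continuous_iff [TopologicalSpace A] {Ψ : A → CrMap r U F} :
    Continuous Ψ ↔ ∀ (k : ℕ) (hk : (k : ℕ∞) ≤ r), Continuous fun a => CrMap.diffC k hk (Ψ a) := by
  refine ⟨fun h k hk => (CrMap.continuous_diffC k hk).comp h, fun h => ?_⟩
  exact continuous_iInf_rng.2 fun k => continuous_iInf_rng.2 fun hk => continuous_induced_rng.2
    (h k hk)

theorem CrMap.tendsto_nhds {l : Filter A} {Ψ : A → CrMap r U F} {f : CrMap r U F}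
    (h : ∀ (k : ℕ) (hk : (k : ℕ∞) ≤ r),
      Tendsto (fun a => CrMap.diffC k hk (Ψ a)) l (𝓝 (CrMap.diffC k hk f))) :
    Tendsto Ψ l (𝓝 f) := by
  rw [nhds_iInf, tendsto_iInf]
  intro k
  rw [nhds_iInf, tendsto_iInf]
  intro hk
  rw [nhds_induced, tendsto_comap_iff]
  exact h k hk

theorem CrMap.continuous_diff_apply (k : ℕ) (hk : (k : ℕ∞) ≤ r) (p : U × (Fin k → E)) :
    Continuous fun f : CrMap r U F => f.diff k p :=
  (continuous_eval_const p).comp (CrMap.continuous_diffC k hk)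

/-- Point evaluations are continuous and separate points. The Hausdorff property is needed for
uniqueness of the differentials of maps into C^s(V, F). -/
instance CrMap.instT2Space [T2Space F] : T2Space (CrMap r U F) := by
  refine T2Space.of_injective_continuous (f := fun (f : CrMap r U F) (x : U) => f x)
    (fun f g h => CrMap.ext fun x => congrFun h x) (continuous_pi fun x => ?_)
  refine (CrMap.continuous_diff_apply 0 (by simp) (x, 0)).congr fun f => ?_
  exact f.hasDiffs.zero x 0

theorem CrMap.continuous_of_continuous_postcomp {X : Type*} [TopologicalSpace X]
    [TopologicalSpace A] {Ψ : A → C(X, CrMap r U F)}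
    (h : ∀ (k : ℕ) (hk : (k : ℕ∞) ≤ r), Continuous fun a =>
      (⟨CrMap.diffC k hk, CrMap.continuous_diffC k hk⟩ :
        C(CrMap r U F, C(U × (Fin k → E), F))).comp (Ψ a)) : Continuous Ψ := by
  let _ := IsTopologicalAddGroup.rightUniformSpace F
  refine ContinuousMap.continuous_of_continuous_postcomp
    (J := {k : ℕ // (k : ℕ∞) ≤ r}) (Z := fun k => C(U × (Fin k.1 → E), F))
    (fun k => CrMap.diffC k.1 k.2) (fun k => CrMap.continuous_diffC k.1 k.2) ?_ fun k => h k.1 k.2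
  exact iInf_subtype'

end CrMapTopology

/-! ### The exponential law -/

section Exponential

variable {E₁ E₂ F : Type*}
  [AddCommGroup E₁] [Module ℝ E₁] [TopologicalSpace E₁] [IsTopologicalAddGroup E₁]
  [ContinuousSMul ℝ E₁]
  [AddCommGroup E₂] [Module ℝ E₂] [TopologicalSpace E₂] [IsTopologicalAddGroup E₂]
  [ContinuousSMul ℝ E₂]
  [AddCommGroup F] [Module ℝ F] [TopologicalSpace F] [IsTopologicalAddGroup F]
  [ContinuousSMul ℝ F] [LocallyConvexSpace ℝ F] [T2Space F]
  {U : Set E₁} {V : Set E₂} [IsLocConvexDenseInterior U] [IsLocConvexDenseInterior V]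
  {r s : ℕ∞}

/-- The definition provides derivatives in the second variable only for i = 0. Induction on i moves
such a derivative past one derivative in the first variable at a time. -/
theorem HasDiffs₂.hasDirDeriv_right_of_mem_interior {f : U × V → F}
    {D : ∀ i j : ℕ, U × V × (Fin i → E₁) × (Fin j → E₂) → F} (h : HasDiffs₂ r s f D)
    (i j : ℕ) (hi : (i : ℕ∞) ≤ r) (hj : ((j + 1 : ℕ) : ℕ∞) ≤ s) (x : U) (y : V)
    (hx : (x : E₁) ∈ interior U) (hy : (y : E₂) ∈ interior V) (w : Fin i → E₁)
    (v : Fin (j + 1) → E₂) :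
    HasDirDeriv (fun z : V => D i j (x, z, w, Fin.init v)) y (v (Fin.last j))
      (D i (j + 1) (x, y, w, v)) := by
  induction i generalizing x y with
  | zero => exact h.succ_right j hj x y hx hy w v
  | succ i ih =>
    have hi' := natCast_le_of_succ_le hi
    have hj' := natCast_le_of_succ_le hj
    exact HasDirDeriv.of_mixed_prod
      (h := fun p : U × V => D i j (p.1, p.2, Fin.init w, Fin.init v))
      (h₁ := fun p : U × V => D (i + 1) j (p.1, p.2, w, Fin.init v))
      (h₂ := fun p : U × V => D i (j + 1) (p.1, p.2, Fin.init w, v))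
      (h₂₁ := fun p : U × V => D (i + 1) (j + 1) (p.1, p.2, w, v)) (a := w (Fin.last i))
      ((h.continuous (i + 1) (j + 1) hi hj).comp (by fun_prop))
      (fun x y hx hy => h.succ_left i j hi hj' x y hx hy w (Fin.init v))
      (fun x y hx hy => ih hi' x y hx hy (Fin.init w))
      (fun x y hx hy => h.succ_left i (j + 1) hi hj x y hx hy w v) hx hy

/-- The derivatives in the second variable also exist at boundary points in the first one. -/
theorem HasDiffs₂.hasDirDeriv_right {f : U × V → F}
    {D : ∀ i j : ℕ, U × V × (Fin i → E₁) × (Fin j → E₂) → F} (h : HasDiffs₂ r s f D)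
    (i j : ℕ) (hi : (i : ℕ∞) ≤ r) (hj : ((j + 1 : ℕ) : ℕ∞) ≤ s) (x : U) (y : V)
    (hy : (y : E₂) ∈ interior V) (w : Fin i → E₁) (v : Fin (j + 1) → E₂) :
    HasDirDeriv (fun z : V => D i j (x, z, w, Fin.init v)) y (v (Fin.last j))
      (D i (j + 1) (x, y, w, v)) :=
  HasDirDeriv.of_dense dense_interior_subtype
    (h := fun p : V × U => D i j (p.2, p.1, w, Fin.init v))
    (dh := fun p : V × U => D i (j + 1) (p.2, p.1, w, v))
    ((h.continuous i j hi (natCast_le_of_succ_le hj)).comp (by fun_prop))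
    ((h.continuous i (j + 1) hi hj).comp (by fun_prop))
    (fun y hy x hx => h.hasDirDeriv_right_of_mem_interior i j hi hj x y hx hy w v) hy x

theorem HasDiffs₂.hasDiffs_right {f : U × V → F}
    {D : ∀ i j : ℕ, U × V × (Fin i → E₁) × (Fin j → E₂) → F} (h : HasDiffs₂ r s f D)
    (i : ℕ) (hi : (i : ℕ∞) ≤ r) (x : U) (w : Fin i → E₁) :
    HasDiffs s (fun y => D i 0 (x, y, w, 0)) (fun j p => D i j (x, p.1, w, p.2)) where
  zero y v := by rw [Subsingleton.elim v 0]
  continuous j hj := (h.continuous i j hi hj).comp (by fun_prop)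
  succ j hj y hy v := h.hasDirDeriv_right i j hi hj x y hy w v

/-- The partial map `d^(i,0) f (x, ·, w)` of a `C^{r,s}`-map, as a `C^s`-map. -/
noncomputable def CrsMap.partialDiff (f : CrsMap r s U V F) (i : ℕ) (hi : (i : ℕ∞) ≤ r)
    (p : U × (Fin i → E₁)) : CrMap s V F :=
  ⟨fun y => f.diff i 0 (p.1, y, p.2, 0), _, f.hasDiffs₂.hasDiffs_right i hi p.1 p.2⟩

theorem CrsMap.partialDiff_diff (f : CrsMap r s U V F) (i : ℕ) (hi : (i : ℕ∞) ≤ r)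
    (p : U × (Fin i → E₁)) (j : ℕ) (hj : (j : ℕ∞) ≤ s) (q : V × (Fin j → E₂)) :
    (f.partialDiff i hi p).diff j q = f.diff i j (p.1, q.1, p.2, q.2) :=
  congrFun ((f.partialDiff i hi p).hasDiffs.unique
    (f.hasDiffs₂.hasDiffs_right i hi p.1 p.2) j hj) q

/-- The map `((x, w), (y, v)) ↦ (x, y, w, v)`. -/
def prodShuffle (U : Set E₁) (V : Set E₂) (i j : ℕ) :
    C((U × (Fin i → E₁)) × (V × (Fin j → E₂)), U × V × (Fin i → E₁) × (Fin j → E₂)) :=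
  ⟨fun p => (p.1.1, p.2.1, p.1.2, p.2.2), by fun_prop⟩

/-- The inverse of `prodShuffle`. -/
def prodUnshuffle (U : Set E₁) (V : Set E₂) (i j : ℕ) :
    C(U × V × (Fin i → E₁) × (Fin j → E₂), (U × (Fin i → E₁)) × (V × (Fin j → E₂))) :=
  ⟨fun p => ((p.1, p.2.2.1), (p.2.1, p.2.2.2)), by fun_prop⟩

theorem CrsMap.diffC_partialDiff (f : CrsMap r s U V F) (i : ℕ) (hi : (i : ℕ∞) ≤ r)
    (p : U × (Fin i → E₁)) (j : ℕ) (hj : (j : ℕ∞) ≤ s) :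
    CrMap.diffC j hj (f.partialDiff i hi p) =
      ((f.diffC i j hi hj).comp (prodShuffle U V i j)).curry p :=
  ContinuousMap.ext fun q => f.partialDiff_diff i hi p j hj q

theorem CrsMap.continuous_partialDiff (f : CrsMap r s U V F) (i : ℕ) (hi : (i : ℕ∞) ≤ r) :
    Continuous (f.partialDiff i hi) := by
  rw [CrMap.continuous_iff]
  intro j hj
  simp only [f.diffC_partialDiff]
  exact ContinuousMap.continuous _

/-- The map `f^∨ : x ↦ f (x, ·)`. -/
noncomputable def CrsMap.curry (f : CrsMap r s U V F) (x : U) : CrMap s V F :=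
  ⟨fun y => f (x, y), by
    have e : (fun y => f (x, y)) = fun y => f.partialDiff 0 (by simp) (x, 0) y :=
      funext fun y => (f.hasDiffs₂.zero x y 0 0).symm
    rw [e]
    exact (f.partialDiff 0 (by simp) (x, 0)).isCr⟩

open Classical in
/-- The differentials of `f^∨`. -/
noncomputable def CrsMap.curryDiff (f : CrsMap r s U V F) (i : ℕ) (p : U × (Fin i → E₁)) : CrMap s V F :=
  -- The value 0 for i > r is harmless: `HasDiffs` imposes conditions only up to order r.
  if hi : (i : ℕ∞) ≤ r then f.partialDiff i hi p else 0

theorem CrsMap.curryDiff_of_le (f : CrsMap r s U V F) {i : ℕ} (hi : (i : ℕ∞) ≤ r) :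
    f.curryDiff i = f.partialDiff i hi :=
  funext fun _ => dif_pos hi

/-- For the derivatives, convergence in C^s(V, F) is tested after each d^(j), where it follows from
convergence in F locally uniform in the parameter (y, v). Thus the mean value inclusion is needed
only in F. -/
theorem CrsMap.hasDiffs_curry (f : CrsMap r s U V F) : HasDiffs r f.curry f.curryDiff where
  zero x w := by
    rw [f.curryDiff_of_le (by simp)]
    refine CrMap.ext fun y => ?_
    exact f.hasDiffs₂.zero x y w 0
  continuous i hi := by
    rw [f.curryDiff_of_le hi]
    exact f.continuous_partialDiff i hi
  succ i hi x hx w := by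
    have hi' := natCast_le_of_succ_le hi
    rw [f.curryDiff_of_le hi, f.curryDiff_of_le hi']
    refine CrMap.tendsto_nhds fun j hj => ?_
    have hev := (eventually_add_smul_mem_interior hx (w (Fin.last i))).filter_mono
      (nhdsWithin_le_nhds (s := {0}ᶜ))
    refine ContinuousMap.tendsto_of_tendsto_prod fun q => ?_
    -- The derivatives in x are known only for y in the interior of V, hence for a dense set of
    -- parameters.
    have hd : Dense {q : V × (Fin j → E₂) | (q.1 : E₂) ∈ interior V} :=
      dense_interior_subtype.preimage isOpenMap_fst
    have key := HasDirDeriv.tendsto_of_dense hd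
      (h := fun p : U × (V × (Fin j → E₂)) => f.diff i j (p.1, p.2.1, Fin.init w, p.2.2))
      (dh := fun p : U × (V × (Fin j → E₂)) => f.diff (i + 1) j (p.1, p.2.1, w, p.2.2))
      (w := w (Fin.last i))
      ((f.hasDiffs₂.continuous i j hi' hj).comp (by fun_prop))
      ((f.hasDiffs₂.continuous (i + 1) j hi hj).comp (by fun_prop))
      (fun x hx q hq => f.hasDiffs₂.succ_left i j hi hj x q.1 hx hq w q.2) hx q
    rw [f.diffC_partialDiff]
    refine Tendsto.congr' ?_ key
    filter_upwards [hev.prod_inl (𝓝 q)] with p hp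
    rw [extend_val_mk _ (interior_subset hp), extend_val_mk _ (interior_subset hp)]
    change _ = CrMap.diffL j hj (_ • (_ - _)) p.2
    rw [map_smul, map_sub]
    change _ = p.1⁻¹ • ((f.partialDiff i hi' _).diff j p.2 - (f.partialDiff i hi' _).diff j p.2)
    rw [f.partialDiff_diff _ _ _ _ hj, f.partialDiff_diff _ _ _ _ hj]

/-! ### The inverse map -/

/-- The partial differentials of `g^∧`. -/
noncomputable def uncurryDiff (D : ∀ i : ℕ, U × (Fin i → E₁) → CrMap s V F) (i j : ℕ)
    (p : U × V × (Fin i → E₁) × (Fin j → E₂)) : F :=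
  (D i (p.1, p.2.2.1)).diff j (p.2.1, p.2.2.2)

variable {g : U → CrMap s V F} {D : ∀ i : ℕ, U × (Fin i → E₁) → CrMap s V F}

/-- Evaluation φ ↦ d^(j) φ (q) is continuous and linear, so it commutes with differentials. This
makes results for F-valued maps, such as polarization, applicable to g. -/
theorem HasDiffs.hasDiffs_diff_apply (h : HasDiffs r g D) {j : ℕ} (hj : (j : ℕ∞) ≤ s)
    (q : V × (Fin j → E₂)) :
    HasDiffs r (fun x => (g x).diff j q) (fun i p => (D i p).diff j q) where
  zero x w := by rw [h.zero]
  continuous i hi := (CrMap.continuous_diff_apply j hj q).comp (h.continuous i hi)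
  succ i hi x hx w := (h.succ i hi x hx w).clm_comp
    { toFun := fun φ => φ.diff j q
      map_add' := fun φ ψ => congrArg (fun c : C(_, F) => c q) (map_add (CrMap.diffL j hj) φ ψ)
      map_smul' := fun c φ => congrArg (fun c : C(_, F) => c q) (map_smul (CrMap.diffL j hj) c φ) }
    (CrMap.continuous_diff_apply j hj q)

/-- By polarization, continuity of the partial differentials only has to be checked on diagonals. -/
theorem HasDiffs.continuous_uncurryDiff_of_diag (h : HasDiffs r g D) {i j : ℕ}
    (hi : (i : ℕ∞) ≤ r) (hj : (j : ℕ∞) ≤ s)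
    (hc : Continuous fun p : U × V × E₁ × E₂ =>
      uncurryDiff D i j (p.1, p.2.1, fun _ => p.2.2.1, fun _ => p.2.2.2)) :
    Continuous (uncurryDiff D i j) := by
  -- Polarize in w for the map x ↦ d^(j)(g x)(q), then in v for each resulting C^s-map.
  have e : uncurryDiff D i j = fun p => ((i.factorial : ℝ)⁻¹) • ∑ S : Finset (Fin i),
      (-1 : ℤ) ^ S.card • (((j.factorial : ℝ)⁻¹) • ∑ T : Finset (Fin j),
        (-1 : ℤ) ^ T.card • uncurryDiff D i j
          (p.1, p.2.1, fun _ => ∑ a ∈ Sᶜ, p.2.2.1 a, fun _ => ∑ a ∈ Tᶜ, p.2.2.2 a)) := by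
    funext p
    refine ((h.hasDiffs_diff_apply hj (p.2.1, p.2.2.2)).polarization i hi p.1 p.2.2.1).trans ?_
    simp only [uncurryDiff]
    congr 1
    refine Finset.sum_congr rfl fun S _ => ?_
    congr 1
    exact (D i (p.1, fun _ => ∑ a ∈ Sᶜ, p.2.2.1 a)).hasDiffs.polarization j hj p.2.1 p.2.2.2
  rw [e]
  refine Continuous.const_smul (continuous_finsetSum _ fun S _ => Continuous.zsmul
    (Continuous.const_smul (continuous_finsetSum _ fun T _ => Continuous.zsmul ?_ _) _) _) _
  exact hc.comp (f := fun p : U × V × (Fin i → E₁) × (Fin j → E₂) =>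
    (p.1, p.2.1, ∑ a ∈ Sᶜ, p.2.2.1 a, ∑ a ∈ Tᶜ, p.2.2.2 a)) (by fun_prop)

theorem HasDiffs.continuous_uncurryDiff_comp (h : HasDiffs r g D) [T2Space E₂] {i j : ℕ}
    (hi : (i : ℕ∞) ≤ r) (hj : (j : ℕ∞) ≤ s) {W : Type*} [TopologicalSpace W] (hW : IsKSpace W)
    {a : W → U} {b : W → V} {c : W → Fin i → E₁} {d : W → Fin j → E₂} (ha : Continuous a)
    (hb : Continuous b) (hc : Continuous c) (hd : Continuous d) :
    Continuous fun p => uncurryDiff D i j (a p, b p, c p, d p) :=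
  hW.continuous_uncurry ((CrMap.continuous_diffC j hj).comp (h.continuous i hi))
    (ha.prodMk hc) (hb.prodMk hd)

/-- A compact neighbourhood in V of an interior point is a neighbourhood in E₂, and translations
carry it everywhere. Hence V × E₂^j is locally compact as well. -/
theorem locallyCompactSpace_of_subset [LocallyCompactSpace V] [Nonempty V] :
    LocallyCompactSpace E₂ := by
  obtain ⟨y, hy⟩ := (dense_interior_subtype (U := V)).nonempty
  obtain ⟨K, hK, hKy⟩ := exists_compact_mem_nhds y
  refine (hK.image continuous_subtype_val).locallyCompactSpace_of_mem_nhds_of_addGroup (x := y) ?_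
  rw [← map_val_nhds_of_mem_interior hy]
  exact image_mem_map hKy

theorem HasDiffs.continuous_uncurryDiff_of_locallyCompactSpace (h : HasDiffs r g D)
    [LocallyCompactSpace V] {i j : ℕ} (hi : (i : ℕ∞) ≤ r) (hj : (j : ℕ∞) ≤ s) :
    Continuous (uncurryDiff D i j) := by
  rw [continuous_iff_continuousAt]
  intro p
  -- Continuity is checked at a point p in order to have a point of V at hand.
  have : Nonempty V := ⟨p.2.1⟩
  have := locallyCompactSpace_of_subset (V := V)
  refine Continuous.continuousAt ?_
  have hc : Continuous fun p : U × (Fin i → E₁) => CrMap.diffC j hj (D i p) :=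
    (CrMap.continuous_diffC j hj).comp (h.continuous i hi)
  exact (hc.comp (f := fun p : U × V × (Fin i → E₁) × (Fin j → E₂) => (p.1, p.2.2.1))
    (by fun_prop)).eval (g := fun p => (p.2.1, p.2.2.2)) (by fun_prop)

theorem HasDiffs.continuous_uncurryDiff [T2Space E₂] (h : HasDiffs r g D)
    (hyp : LocallyCompactSpace V ∨
      (r = 0 ∧ s = 0 ∧ IsKSpace (U × V)) ∨
      (1 ≤ r ∧ s = 0 ∧ IsKSpace (U × V × E₁)) ∨
      (r = 0 ∧ 1 ≤ s ∧ IsKSpace (U × V × E₂)) ∨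
      (1 ≤ r ∧ 1 ≤ s ∧ IsKSpace (U × V × E₁ × E₂)))
    {i j : ℕ} (hi : (i : ℕ∞) ≤ r) (hj : (j : ℕ∞) ≤ s) : Continuous (uncurryDiff D i j) := by
  -- If r = 0 or s = 0, only i = 0 or j = 0 occurs, so the map factors through a product without E₁
  -- or E₂; polarization handles the remaining powers.
  rcases hyp with hV | ⟨hr, hs, hW⟩ | ⟨-, hs, hW⟩ | ⟨hr, -, hW⟩ | ⟨-, -, hW⟩
  · exact h.continuous_uncurryDiff_of_locallyCompactSpace hi hj
  · obtain rfl : i = 0 := by simpa [hr] using hi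
    obtain rfl : j = 0 := by simpa [hs] using hj
    refine ((h.continuous_uncurryDiff_comp hi hj hW (a := fun p => p.1) (b := fun p => p.2)
      (c := fun _ => 0) (d := fun _ => 0) (by fun_prop) (by fun_prop) (by fun_prop)
      (by fun_prop)).comp (f := fun p : U × V × (Fin 0 → E₁) × (Fin 0 → E₂) => (p.1, p.2.1))
      (by fun_prop)).congr fun p => ?_
    simp only [Function.comp_apply]
    rw [Subsingleton.elim (0 : Fin 0 → E₁) p.2.2.1, Subsingleton.elim (0 : Fin 0 → E₂) p.2.2.2]
  · obtain rfl : j = 0 := by simpa [hs] using hj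
    refine h.continuous_uncurryDiff_of_diag hi hj ?_
    refine ((h.continuous_uncurryDiff_comp hi hj hW (a := fun p => p.1) (b := fun p => p.2.1)
      (c := fun p _ => p.2.2) (d := fun _ => 0) (by fun_prop) (by fun_prop) (by fun_prop)
      (by fun_prop)).comp (f := fun p : U × V × E₁ × E₂ => (p.1, p.2.1, p.2.2.1))
      (by fun_prop)).congr fun p => ?_
    simp only [Function.comp_apply]
    rw [Subsingleton.elim (0 : Fin 0 → E₂) fun _ => p.2.2.2]
  · obtain rfl : i = 0 := by simpa [hr] using hi
    refine h.continuous_uncurryDiff_of_diag hi hj ?_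
    refine ((h.continuous_uncurryDiff_comp hi hj hW (a := fun p => p.1) (b := fun p => p.2.1)
      (c := fun _ => 0) (d := fun p _ => p.2.2) (by fun_prop) (by fun_prop) (by fun_prop)
      (by fun_prop)).comp (f := fun p : U × V × E₁ × E₂ => (p.1, p.2.1, p.2.2.2))
      (by fun_prop)).congr fun p => ?_
    simp only [Function.comp_apply]
    rw [Subsingleton.elim (0 : Fin 0 → E₁) fun _ => p.2.2.1]
  · refine h.continuous_uncurryDiff_of_diag hi hj ?_
    exact h.continuous_uncurryDiff_comp hi hj hW (a := fun p => p.1) (b := fun p => p.2.1)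
      (c := fun p _ => p.2.2.1) (d := fun p _ => p.2.2.2) (by fun_prop) (by fun_prop)
      (by fun_prop) (by fun_prop)

/-- Derivatives in y are those of the C^s-map d^(0) g (x, w); derivatives in x come from evaluating
those of g. Joint continuity is the only extra input. -/
theorem HasDiffs.hasDiffs₂_uncurry (h : HasDiffs r g D)
    (hc : ∀ i j : ℕ, (i : ℕ∞) ≤ r → (j : ℕ∞) ≤ s → Continuous (uncurryDiff D i j)) :
    HasDiffs₂ r s (fun p : U × V => g p.1 p.2) (uncurryDiff D) where
  zero x y w v := by
    simp only [uncurryDiff, h.zero]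
    exact (g x).hasDiffs.zero y v
  continuous := hc
  succ_right j hj x y _ hy w v := (D 0 (x, w)).hasDiffs.succ j hj y hy v
  succ_left i j hi hj x y hx _ w v := (h.hasDiffs_diff_apply hj (y, v)).succ i hi x hx w

/-! ### Continuity of Φ and of its inverse -/

/-- `f ↦ f^∨` as a map into `C^r(U, C^s(V, F))`. -/
noncomputable def CrsMap.curryCr (f : CrsMap r s U V F) : CrMap r U (CrMap s V F) :=
  ⟨f.curry, f.curryDiff, f.hasDiffs_curry⟩

theorem CrsMap.diffC_curryCr (f : CrsMap r s U V F) (i : ℕ) (hi : (i : ℕ∞) ≤ r)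
    (p : U × (Fin i → E₁)) : CrMap.diffC i hi f.curryCr p = f.partialDiff i hi p := by
  rw [← f.curryDiff_of_le hi]
  exact congrFun (f.curryCr.hasDiffs.unique f.hasDiffs_curry i hi) p

theorem CrsMap.continuous_diffC (i j : ℕ) (hi : (i : ℕ∞) ≤ r) (hj : (j : ℕ∞) ≤ s) :
    Continuous (CrsMap.diffC (F := F) (U := U) (V := V) i j hi hj) :=
  continuous_iff_le_induced.2 ((iInf₂_le i j).trans (iInf₂_le hi hj))

theorem CrsMap.continuous_iff {A : Type*} [TopologicalSpace A] {Ψ : A → CrsMap r s U V F} :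
    Continuous Ψ ↔ ∀ (i j : ℕ) (hi : (i : ℕ∞) ≤ r) (hj : (j : ℕ∞) ≤ s),
      Continuous fun a => CrsMap.diffC i j hi hj (Ψ a) := by
  refine ⟨fun h i j hi hj => (CrsMap.continuous_diffC i j hi hj).comp h, fun h => ?_⟩
  exact continuous_iInf_rng.2 fun i => continuous_iInf_rng.2 fun j =>
    continuous_iInf_rng.2 fun hi => continuous_iInf_rng.2 fun hj =>
      continuous_induced_rng.2 (h i j hi hj)

/-- This identity matches the maps defining the two topologies; both continuity statements reduce to
it. -/
theorem CrsMap.postcomp_diffC_curryCr (f : CrsMap r s U V F) (i j : ℕ) (hi : (i : ℕ∞) ≤ r)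
    (hj : (j : ℕ∞) ≤ s) :
    (⟨CrMap.diffC j hj, CrMap.continuous_diffC j hj⟩ :
        C(CrMap s V F, C(V × (Fin j → E₂), F))).comp (CrMap.diffC i hi f.curryCr) =
      ((f.diffC i j hi hj).comp (prodShuffle U V i j)).curry := by
  refine ContinuousMap.ext fun p => ?_
  rw [← f.diffC_partialDiff, ContinuousMap.comp_apply, f.diffC_curryCr]
  rfl

theorem CrsMap.continuous_curryCr :
    Continuous (CrsMap.curryCr : CrsMap r s U V F → CrMap r U (CrMap s V F)) := by
  let _ := IsTopologicalAddGroup.rightUniformSpace F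
  rw [CrMap.continuous_iff]
  intro i hi
  refine CrMap.continuous_of_continuous_postcomp fun j hj => ?_
  simp only [CrsMap.postcomp_diffC_curryCr]
  exact (ContinuousMap.continuous_curry_comp _).comp (CrsMap.continuous_diffC i j hi hj)

/-- Continuity of a map into `C^{r,s}(U × V, F)` can be checked after currying. -/
theorem CrsMap.continuous_of_continuous_curryCr {A : Type*} [TopologicalSpace A]
    {Ψ : A → CrsMap r s U V F} (h : Continuous fun a => (Ψ a).curryCr) : Continuous Ψ := by
  let _ := IsTopologicalAddGroup.rightUniformSpace F
  rw [CrsMap.continuous_iff]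
  intro i j hi hj
  have h1 : Continuous fun a => (CrsMap.diffC i j hi hj (Ψ a)).comp (prodShuffle U V i j) := by
    refine ContinuousMap.continuous_of_continuous_curry ?_
    simp only [← CrsMap.postcomp_diffC_curryCr]
    exact (ContinuousMap.continuous_postcomp _).comp ((CrMap.continuous_iff.1 h) i hi)
  exact (ContinuousMap.continuous_precomp (prodUnshuffle U V i j)).comp h1

end Exponential

theorem theorem3
    {E₁ E₂ F : Type*}
    [AddCommGroup E₁] [Module ℝ E₁] [TopologicalSpace E₁] [IsTopologicalAddGroup E₁]
    [ContinuousSMul ℝ E₁] [LocallyConvexSpace ℝ E₁] [T2Space E₁]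
    [AddCommGroup E₂] [Module ℝ E₂] [TopologicalSpace E₂] [IsTopologicalAddGroup E₂]
    [ContinuousSMul ℝ E₂] [LocallyConvexSpace ℝ E₂] [T2Space E₂]
    [AddCommGroup F] [Module ℝ F] [TopologicalSpace F] [IsTopologicalAddGroup F]
    [ContinuousSMul ℝ F] [LocallyConvexSpace ℝ F] [T2Space F]
    (U : Set E₁) (V : Set E₂) [IsLocConvexDenseInterior U] [IsLocConvexDenseInterior V]
    (r s : ℕ∞)
    (h : LocallyCompactSpace V ∨
      (r = 0 ∧ s = 0 ∧ IsKSpace (U × V)) ∨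
      (1 ≤ r ∧ s = 0 ∧ IsKSpace (U × V × E₁)) ∨
      (r = 0 ∧ 1 ≤ s ∧ IsKSpace (U × V × E₂)) ∨
      (1 ≤ r ∧ 1 ≤ s ∧ IsKSpace (U × V × E₁ × E₂))) :
    (∃ Φ : CrsMap r s U V F ≃L[ℝ] CrMap r U (CrMap s V F),
      ∀ (f : CrsMap r s U V F) (x : U) (y : V), Φ f x y = f (x, y)) ∧
    (∀ g : U → CrMap s V F, IsCr r g → IsCrs r s (fun p : U × V => g p.1 p.2)) := by
  have huncurry : ∀ g : U → CrMap s V F, IsCr r g → IsCrs r s (fun p : U × V => g p.1 p.2) :=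
    fun g ⟨_, hD⟩ => ⟨_, hD.hasDiffs₂_uncurry fun _ _ hi hj => hD.continuous_uncurryDiff h hi hj⟩
  refine ⟨⟨{ toFun := CrsMap.curryCr
             map_add' := fun _ _ => rfl
             map_smul' := fun _ _ => rfl
             invFun := fun g => ⟨fun p => g p.1 p.2, huncurry g g.isCr⟩
             left_inv := fun _ => rfl
             right_inv := fun _ => rfl
             continuous_toFun := CrsMap.continuous_curryCr
             -- Currying after the inverse is the identity.
             continuous_invFun := CrsMap.continuous_of_continuous_curryCr continuous_id },
    fun _ _ _ => rfl⟩, huncurry⟩
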